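/- Let $U$ be a complex vector space of dimension $2$ with basis $\{x,y\}$, let $n>2$ be an integer and let $\alpha\neq\beta$ be integers. Let $t\in\mathbb C^*$ act on $U$ by $\mathrm{diag}(t^{\alpha},t^{\beta})$ in the basis $\{x,y\}$, hence on $S^nU$ and on $\bigwedge^2 S^nU$. For $1\le k\le 2n-1$ let $$E_k=\{u\in \textstyle\bigwedge^2 S^nU \;:\; t\cdot u=t^{2n\alpha+k(\beta-\alpha)}u \text{ for all } t\in\mathbb C^*\}$$ (the span of the vectors $x^{n-p}y^{p}\wedge x^{n-q}y^{q}$ with $p<q$, $p+q=k$), and let $\mathbb P(E_k^*)$ be the projective space of hyperplanes of $E_k$. Say that a subspace $W\subset\bigwedge^2 S^nU$ satisfies condition $(*)$ if $\dim W=\binom{n+1}{2}-2n+1$ and $W$ contains no nonzero decomposable vector $a\wedge b$. Let $\mathcal W$ be the set of $\mathbb C^*$-invariant subspaces $W\subset\bigwedge^2 S^nU$ satisfying $(*)$. Let $\mathbb P^n=\mathbb P(V)$ be the space of lines of $V=S^nU$, and let $Q$ be the quotient bundle, defined by $0\to\mathcal O(-1)\to V\otimes\mathcal O\to Q\to0$.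 The map $V\otimes\mathcal O(-1)\to\bigwedge^2V\otimes\mathcal O$, $a\otimes v\mapsto a\wedge v$ (for $v$ in the line $\mathcal O(-1)_{[v]}$), factors through a morphism $Q(-1)\to\bigwedge^2V\otimes\mathcal O$. For a subspace $W$ satisfying $(*)$ let $\varpi_W:Q(-1)\to(\bigwedge^2V/W)\otimes\mathcal O$ be the induced morphism, and let the Tango bundle $F(W)$ be defined by $F(W)(1)=\operatorname{coker}\varpi_W$. (1) For every $3\le k\le 2n-3$, the set $\mathcal Z_k\subset\mathbb P(E_k^*)$ of the hyperplanes of $E_k$ that contain no nonzero decomposable vector is a nonempty Zariski open subset, and $$\mathcal W=\Big\{\bigoplus_{3\le k\le 2n-3}W_k \;:\; W_k\in\mathcal Z_k \text{ for } 3\le k\le 2n-3\Big\}.$$ (2) For every $W\in\mathcal W$ there is a $\mathbb C^*$-invariant subspace $D_W\subset\bigwedge^2V$ with $\bigwedge^2V=D_W\oplus W$, and, identifying $\bigwedge^2V/W$ with $D_W$, the sequence $$0\longrightarrow Q(-1)\stackrel{\varpi_W}{\longrightarrow}D_W\otimes\mathcal O\longrightarrow F(W)(1)\longrightarrow0$$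 is an exact sequence of sheaves of $\mathcal O$-modules on $\mathbb P^n$; moreover $\varpi_W$ is injective on the fibre at every point of $\mathbb P^n$, with cokernel of dimension $n-1$. -/

import Mathlib

open CategoryTheory TopologicalSpace Opposite
open scoped LinearAlgebra.Projectivization

universe u w

namespace TangoBundle

noncomputable section

/-! ## The projective space `P(V)` of lines in `V`, with its Zariski topology -/

/-- The value at `v` of a polynomial in the linear forms on `V`. -/
def polyEval {V : Type u} [AddCommGroup V] [Module ℂ V]
    (p : MvPolynomial (Module.Dual ℂ V) ℂ) (v : V) : ℂ :=
  MvPolynomial.eval (fun ξ : Module.Dual ℂ V => ξ v) p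

/-- The set of points of `P(V)` where the (homogeneous) polynomial `p` does not vanish. -/
def nonvanishing (V : Type u) [AddCommGroup V] [Module ℂ V]
    (p : MvPolynomial (Module.Dual ℂ V) ℂ) : Set (ℙ ℂ V) :=
  {x | ∀ (v : V) (hv : v ≠ 0), Projectivization.mk ℂ v hv = x → polyEval p v ≠ 0}

/-- The Zariski topology on `P(V)`: its basic open sets are the nonvanishing loci of the
homogeneous polynomials on `V`. -/
instance zariskiTopology (V : Type u) [AddCommGroup V] [Module ℂ V] :
    TopologicalSpace (ℙ ℂ V) :=
  TopologicalSpace.generateFrom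
    {D | ∃ (e : ℕ) (p : MvPolynomial (Module.Dual ℂ V) ℂ),
      p.IsHomogeneous e ∧ D = nonvanishing V p}

/-- The projective variety `P(V)` of lines in `V`, as a topological space. -/
abbrev P (V : Type u) [AddCommGroup V] [Module ℂ V] : TopCat.{u} := TopCat.of (ℙ ℂ V)

section Sheaves

variable {V : Type u} [AddCommGroup V] [Module ℂ V]

/-- The nonzero vectors of the line `x`. -/
def Line (x : ℙ ℂ V) : Type u := {v : V // ∃ hv : v ≠ 0, Projectivization.mk ℂ v hv = x}

/-! ## The sheaves `T ⊗ O(d)`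

A section of `T ⊗ O(d)` over an open set `A` of `P(V)` is a `T`-valued function on the cone over
`A` (the set of nonzero vectors spanning a line that belongs to `A`) which is, locally on `A`,
a quotient of a `T`-valued homogeneous polynomial by a homogeneous polynomial without zeros, the
difference of the two degrees being `d`. In particular it is homogeneous of degree `d`. -/

variable (V) in
/-- The functions that are a quotient of two homogeneous polynomials, of total degree `d`. -/
def isFraction (d : ℤ) (T : Type w) [AddCommGroup T] [Module ℂ T] :
    TopCat.PrelocalPredicate (X := P V) (fun x => (Line x → T)) where
  pred {A} s := ∃ (e : ℕ) (q : MvPolynomial (Module.Dual ℂ V) ℂ),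
    q.IsHomogeneous e ∧ (∀ (x : A) (v : Line x.1), polyEval q v.1 ≠ 0) ∧
      ∀ φ : Module.Dual ℂ T, ∃ (e' : ℕ) (p : MvPolynomial (Module.Dual ℂ V) ℂ),
        (e' : ℤ) = e + d ∧ p.IsHomogeneous e' ∧
          ∀ (x : A) (v : Line x.1), polyEval q v.1 * φ (s x v) = polyEval p v.1
  res := by
    rintro A B i f ⟨e, q, hq, hq0, h⟩
    refine ⟨e, q, hq, fun x v => hq0 ⟨x.1, i.le x.2⟩ v, fun φ => ?_⟩
    obtain ⟨e', p, he, hp, hs⟩ := h φ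
    exact ⟨e', p, he, hp, fun x v => hs ⟨x.1, i.le x.2⟩ v⟩

variable (V) in
/-- The functions that are locally a quotient of homogeneous polynomials, of degree `d`. -/
def isRegular (d : ℤ) (T : Type w) [AddCommGroup T] [Module ℂ T] :
    TopCat.LocalPredicate (X := P V) (fun x => (Line x → T)) :=
  (isFraction V d T).sheafify

lemma exists_dual_ne_zero (v : V) (hv : v ≠ 0) : ∃ ξ : Module.Dual ℂ V, ξ v ≠ 0 := by
  by_contra! h
  exact hv ((Module.forall_dual_apply_eq_zero_iff ℂ v).mp h)

lemma isRegular_zero (d : ℤ) (T : Type w) [AddCommGroup T] [Module ℂ T] (A : Opens (P V)) :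
    (isRegular V d T).pred (U := A) (fun _ _ => 0) := by
  intro x
  obtain ⟨ξ, hξ⟩ := exists_dual_ne_zero x.1.rep x.1.rep_nonzero
  have hD : IsOpen (nonvanishing V (MvPolynomial.X ξ)) :=
    TopologicalSpace.isOpen_generateFrom_of_mem ⟨1, _, MvPolynomial.isHomogeneous_X _ _, rfl⟩
  refine ⟨⟨_, hD⟩ ⊓ A, ⟨?_, x.2⟩, Opens.infLERight _ _, d.natAbs, (MvPolynomial.X ξ) ^ d.natAbs,
    ?_, ?_, fun φ => ⟨(d.natAbs + d).toNat, 0, ?_, MvPolynomial.isHomogeneous_zero _ _ _, ?_⟩⟩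
  · intro v hv hvx
    rw [← x.1.mk_rep, Projectivization.mk_eq_mk_iff] at hvx
    obtain ⟨a, ha⟩ := hvx
    have : a • ξ x.1.rep = ξ v := by rw [← ha]; simp [Units.smul_def]
    simp only [polyEval, MvPolynomial.eval_X, ← this]
    simpa [Units.smul_def] using hξ
  · simpa using (MvPolynomial.isHomogeneous_X ℂ ξ).pow d.natAbs
  · intro y v
    obtain ⟨h0, hv⟩ := v.2
    simpa [polyEval] using fun h => absurd h (by simpa [polyEval] using y.2.1 v.1 h0 hv)
  · omega
  · intro y v
    simp [polyEval]

lemma isRegular_add (d : ℤ) (T : Type w) [AddCommGroup T] [Module ℂ T] (A : Opens (P V))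
    {s t : ∀ x : A, Line x.1 → T} (hs : (isRegular V d T).pred s) (ht : (isRegular V d T).pred t) :
    (isRegular V d T).pred (fun x v => s x v + t x v) := by
  refine TopCat.PrelocalPredicate.sheafify_inductionOn₂' (isFraction V d T) (isFraction V d T)
    (isFraction V d T) (fun a b v => a v + b v) ?_ hs ht
  rintro B C s t ⟨e, q, hq, hq0, h⟩ ⟨f, r, hr, hr0, k⟩
  refine ⟨e + f, q * r, hq.mul hr, fun x v => ?_, fun φ => ?_⟩
  · simpa [polyEval] using And.intro (hq0 ⟨x.1, x.2.1⟩ v) (hr0 ⟨x.1, x.2.2⟩ v)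
  · obtain ⟨e', p, he, hp, h⟩ := h φ
    obtain ⟨f', p', hf, hp', k⟩ := k φ
    refine ⟨e' + f, p * r + q * p', by push_cast; omega, ?_, fun x v => ?_⟩
    · refine (hp.mul hr).add ?_
      have : e' + f = e + f' := by omega
      rw [this]; exact hq.mul hp'
    · have h1 := h ⟨x.1, x.2.1⟩ v
      have h2 := k ⟨x.1, x.2.2⟩ v
      simp only [polyEval, map_mul, map_add] at *
      rw [← h1, ← h2]; ring

lemma isRegular_smul (d₁ d₂ d : ℤ) (hd : d = d₁ + d₂)
    (T : Type w) [AddCommGroup T] [Module ℂ T] (A : Opens (P V))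
    {a : ∀ x : A, Line x.1 → ℂ} {s : ∀ x : A, Line x.1 → T}
    (ha : (isRegular V d₁ ℂ).pred a) (hs : (isRegular V d₂ T).pred s) :
    (isRegular V d T).pred (fun x v => a x v • s x v) := by
  refine TopCat.PrelocalPredicate.sheafify_inductionOn₂' (isFraction V d₁ ℂ) (isFraction V d₂ T)
    (isFraction V d T) (fun a b v => a v • b v) ?_ ha hs
  rintro B C s t ⟨e, q, hq, hq0, h⟩ ⟨f, r, hr, hr0, k⟩
  refine ⟨e + f, q * r, hq.mul hr, fun x v => ?_, fun φ => ?_⟩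
  · simpa [polyEval] using And.intro (hq0 ⟨x.1, x.2.1⟩ v) (hr0 ⟨x.1, x.2.2⟩ v)
  · obtain ⟨e', p, he, hp, h⟩ := h LinearMap.id
    obtain ⟨f', p', hf, hp', k⟩ := k φ
    refine ⟨e' + f', p * p', by push_cast; omega, hp.mul hp', fun x v => ?_⟩
    have h1 := h ⟨x.1, x.2.1⟩ v
    have h2 := k ⟨x.1, x.2.2⟩ v
    simp only [polyEval, map_mul, map_smul, LinearMap.id_apply, smul_eq_mul] at *
    rw [← h1, ← h2]; ring

lemma isRegular_one (A : Opens (P V)) :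
    (isRegular V 0 ℂ).pred (U := A) (fun _ _ => 1) := by
  refine TopCat.PrelocalPredicate.sheafifyOf ⟨0, 1, MvPolynomial.isHomogeneous_one _ _,
    fun x v => by simp [polyEval], fun φ => ⟨0, MvPolynomial.C (φ 1), by simp,
      MvPolynomial.isHomogeneous_C _ _, fun x v => by simp [polyEval]⟩⟩

/-- A fixed linear map sends regular functions to regular functions of the same degree. -/
lemma isRegular_map (d : ℤ) {T T' : Type*} [AddCommGroup T] [Module ℂ T]
    [AddCommGroup T'] [Module ℂ T'] (L : T →ₗ[ℂ] T') (A : Opens (P V))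
    {s : ∀ x : A, Line x.1 → T} (hs : (isRegular V d T).pred s) :
    (isRegular V d T').pred (fun x v => L (s x v)) := by
  intro x
  obtain ⟨B, hB, i, e, q, hq, hq0, h⟩ := hs x
  exact ⟨B, hB, i, e, q, hq, hq0, fun φ => h (φ ∘ₗ L)⟩

/-- A linear map that depends linearly on the point of the cone raises the degree by one. -/
lemma isRegular_bilin [FiniteDimensional ℂ V] (d d' : ℤ) (hd : d' = d + 1)
    {T T' : Type*} [AddCommGroup T] [Module ℂ T]
    [AddCommGroup T'] [Module ℂ T'] (L : V →ₗ[ℂ] T →ₗ[ℂ] T') (A : Opens (P V))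
    {s : ∀ x : A, Line x.1 → T} (hs : (isRegular V d T).pred s) :
    (isRegular V d' T').pred (fun x v => L v.1 (s x v)) := by
  intro x
  obtain ⟨B, hB, i, e, q, hq, hq0, h⟩ := hs x
  refine ⟨B, hB, i, e, q, hq, hq0, fun φ => ?_⟩
  let b := Module.finBasis ℂ V
  choose f p hf hp hs using fun j => h (φ ∘ₗ L (b j))
  obtain ⟨e0, he0⟩ : ∃ e0 : ℕ, (e0 : ℤ) = e + d := by
    obtain ⟨e', _, he, _⟩ := h 0
    exact ⟨e', he⟩
  refine ⟨e0 + 1, ∑ j, MvPolynomial.X (b.coord j) * p j, by push_cast; omega, ?_, fun y v => ?_⟩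
  · refine MvPolynomial.IsHomogeneous.sum _ _ _ fun j _ => ?_
    have : e0 + 1 = 1 + f j := by have := hf j; omega
    rw [this]
    exact (MvPolynomial.isHomogeneous_X _ _).mul (hp j)
  · have key : ∀ t, φ (L v.1 t) = ∑ j, b.coord j v.1 * φ (L (b j) t) := fun t => by
      conv_lhs => rw [← b.sum_repr v.1]
      simp only [map_sum, map_smul, LinearMap.sum_apply, LinearMap.smul_apply, smul_eq_mul,
        Module.Basis.coord_apply]
    simp only [polyEval, map_sum, map_mul, MvPolynomial.eval_X] at hs ⊢
    simp only [← hs _ y v, key, Finset.mul_sum]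
    exact Finset.sum_congr rfl fun j _ => mul_left_comm _ _ _

variable (V) in
/-- The ring of regular functions on an open subset of `P(V)`. -/
def regularFunctions (A : Opens (P V)) : Subring (∀ x : A, Line x.1 → ℂ) where
  carrier := {a | (isRegular V 0 ℂ).pred a}
  zero_mem' := isRegular_zero 0 ℂ A
  one_mem' := isRegular_one A
  add_mem' := isRegular_add 0 ℂ A
  mul_mem' := isRegular_smul 0 0 0 rfl ℂ A
  neg_mem' := fun ha => isRegular_map 0 (-LinearMap.id) A ha

variable (V) in
/-- The sections of `T ⊗ O(d)` over an open subset of `P(V)`. -/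
def twistedSections (d : ℤ) (T : Type w) [AddCommGroup T] [Module ℂ T] (A : Opens (P V)) :
    AddSubgroup (∀ x : A, Line x.1 → T) where
  carrier := {s | (isRegular V d T).pred s}
  zero_mem' := isRegular_zero d T A
  add_mem' := isRegular_add d T A
  neg_mem' := fun ha => isRegular_map d (-LinearMap.id) A ha

instance (d : ℤ) (T : Type w) [AddCommGroup T] [Module ℂ T] (A : Opens (P V)) :
    Module (regularFunctions V A) (twistedSections V d T A) where
  smul a s := ⟨fun x v => a.1 x v • s.1 x v,
    isRegular_smul 0 d d (zero_add d).symm T A a.2 s.2⟩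
  one_smul s := Subtype.ext <| funext fun x => funext fun v => one_smul ℂ (s.1 x v)
  mul_smul a b s := Subtype.ext <| funext fun x => funext fun v =>
    mul_smul (a.1 x v) (b.1 x v) (s.1 x v)
  smul_zero a := Subtype.ext <| funext fun x => funext fun v => smul_zero (a.1 x v)
  smul_add a s t := Subtype.ext <| funext fun x => funext fun v =>
    smul_add (a.1 x v) (s.1 x v) (t.1 x v)
  add_smul a b s := Subtype.ext <| funext fun x => funext fun v =>
    add_smul (a.1 x v) (b.1 x v) (s.1 x v)
  zero_smul s := Subtype.ext <| funext fun x => funext fun v => zero_smul ℂ (s.1 x v)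

variable (V) in
/-- The presheaf of rings of regular functions on `P(V)`. -/
def structurePresheaf : (Opens (P V))ᵒᵖ ⥤ RingCat.{u} where
  obj A := RingCat.of (regularFunctions V A.unop)
  map i := RingCat.ofHom
    { toFun := fun a => ⟨fun x => a.1 ⟨x.1, i.unop.le x.2⟩, (isRegular V 0 ℂ).res i.unop _ a.2⟩
      map_one' := rfl
      map_mul' := fun _ _ => rfl
      map_zero' := rfl
      map_add' := fun _ _ => rfl }

variable (V) in
/-- The structure sheaf `O` of `P(V)`. -/
def structureSheaf : Sheaf (Opens.grothendieckTopology (P V)) RingCat.{u} :=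
  ⟨structurePresheaf V, (TopCat.Presheaf.isSheaf_iff_isSheaf_comp (forget RingCat) _).mpr
    (TopCat.Presheaf.isSheaf_of_iso
      (NatIso.ofComponents (fun _ => Iso.refl _) (by intros; rfl) :
        TopCat.subpresheafToTypes (isRegular V 0 ℂ).toPrelocalPredicate ≅
          structurePresheaf V ⋙ forget RingCat)
      (TopCat.subpresheafToTypes.isSheaf (isRegular V 0 ℂ)))⟩

variable (V) in
/-- The presheaf of abelian groups underlying `T ⊗ O(d)`. -/
def twistedPresheaf (d : ℤ) (T : Type u) [AddCommGroup T] [Module ℂ T] :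
    (Opens (P V))ᵒᵖ ⥤ Ab.{u} where
  obj A := AddCommGrpCat.of (twistedSections V d T A.unop)
  map i := AddCommGrpCat.ofHom
    { toFun := fun a => ⟨fun x => a.1 ⟨x.1, i.unop.le x.2⟩, (isRegular V d T).res i.unop _ a.2⟩
      map_zero' := rfl
      map_add' := fun _ _ => rfl }

instance (d : ℤ) (T : Type u) [AddCommGroup T] [Module ℂ T] (A : (Opens (P V))ᵒᵖ) :
    Module ((structureSheaf V).obj.obj A) ((twistedPresheaf V d T).obj A) :=
  inferInstanceAs (Module (regularFunctions V A.unop) (twistedSections V d T A.unop))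

variable (V) in
/-- The sheaf of modules `T ⊗ O(d)` on `P(V)`. -/
def twisted (d : ℤ) (T : Type u) [AddCommGroup T] [Module ℂ T] :
    SheafOfModules.{u} (structureSheaf V) where
  val := PresheafOfModules.ofPresheaf (twistedPresheaf V d T) (fun _ _ _ _ _ => rfl)
  isSheaf := (TopCat.Presheaf.isSheaf_iff_isSheaf_comp (forget Ab) (twistedPresheaf V d T)).mpr
    (TopCat.Presheaf.isSheaf_of_iso
      (NatIso.ofComponents (fun _ => Iso.refl _) (by intros; rfl) :
        TopCat.subpresheafToTypes (isRegular V d T).toPrelocalPredicate ≅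
          twistedPresheaf V d T ⋙ forget Ab)
      (TopCat.subpresheafToTypes.isSheaf (isRegular V d T)))

/-- The morphism `T ⊗ O(d) ⟶ T' ⊗ O(d')`, `s ↦ (v ↦ L v (s v))`, for a family `L` of linear maps
that preserves regularity. -/
def twistedHom {d d' : ℤ} {T T' : Type u} [AddCommGroup T] [Module ℂ T] [AddCommGroup T']
    [Module ℂ T'] (L : V → T →ₗ[ℂ] T')
    (hL : ∀ (A : Opens (P V)) (s : ∀ x : A, Line x.1 → T), (isRegular V d T).pred s →
      (isRegular V d' T').pred (fun x v => L v.1 (s x v))) :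
    twisted V d T ⟶ twisted V d' T' where
  val := PresheafOfModules.homMk
    { app := fun A => AddCommGrpCat.ofHom
        { toFun := fun s => ⟨fun x v => L v.1 (s.1 x v), hL A.unop s.1 s.2⟩
          map_zero' := Subtype.ext <| funext fun _ => funext fun v => map_zero (L v.1)
          map_add' := fun s t => Subtype.ext <| funext fun x => funext fun v =>
            map_add (L v.1) (s.1 x v) (t.1 x v) }
      naturality := fun _ _ _ => rfl }
    (fun _ r m => Subtype.ext <| funext fun x => funext fun v =>
      map_smul (L v.1) (r.1 x v) (m.1 x v))

variable (V) in
/-- The morphism `L ⊗ O(d) : T ⊗ O(d) ⟶ T' ⊗ O(d)` of a linear map `L`. -/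
def tensorConst (d : ℤ) {T T' : Type u} [AddCommGroup T] [Module ℂ T] [AddCommGroup T']
    [Module ℂ T'] (L : T →ₗ[ℂ] T') : twisted V d T ⟶ twisted V d T' :=
  twistedHom (fun _ => L) (fun A _ hs => isRegular_map d L A hs)

lemma tensorConst_comp (d : ℤ) {T T' T'' : Type u} [AddCommGroup T] [Module ℂ T]
    [AddCommGroup T'] [Module ℂ T'] [AddCommGroup T''] [Module ℂ T'']
    (L : T →ₗ[ℂ] T') (L' : T' →ₗ[ℂ] T'') :
    tensorConst V d L ≫ tensorConst V d L' = tensorConst V d (L' ∘ₗ L) := rfl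

variable [FiniteDimensional ℂ V]

/-- The morphism `T ⊗ O(d) ⟶ T' ⊗ O(d + 1)`, `s ↦ (v ↦ L v (s v))`, of a bilinear map `L`. -/
def tensorLinear (d d' : ℤ) (hd : d' = d + 1) {T T' : Type u} [AddCommGroup T] [Module ℂ T]
    [AddCommGroup T'] [Module ℂ T'] (L : V →ₗ[ℂ] T →ₗ[ℂ] T') :
    twisted V d T ⟶ twisted V d' T' :=
  twistedHom (fun v => L v) (fun A _ hs => isRegular_bilin d d' hd L A hs)

variable (V) in
/-- The tautological inclusion `O(-1) ⟶ V ⊗ O` twisted by `O(m)`, that is the morphism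
`O(m - 1) ⟶ V ⊗ O(m)`, `f ↦ (v ↦ f(v) v)`. -/
def tautological (m : ℤ) : twisted V (m - 1) (ULift.{u} ℂ) ⟶ twisted V m V :=
  tensorLinear (m - 1) m (by ring)
    ((LinearMap.lsmul ℂ V).flip.compl₂ ULift.moduleEquiv.toLinearMap)

variable (V) in
/-- The twist `Q(m)` of the quotient bundle `Q` of `P(V)`, as the cokernel of the twisted Euler
sequence `0 ⟶ O(m - 1) ⟶ V ⊗ O(m) ⟶ Q(m) ⟶ 0`. -/
def quotientBundle (m : ℤ) : SheafOfModules.{u} (structureSheaf V) :=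
  Limits.cokernel (tautological V m)

end Sheaves

/-! ## Tango bundles -/

section Tango

variable {V : Type u} [AddCommGroup V] [Module ℂ V]

/-- The decomposable bivector `a ∧ b`. -/
def wedge (a b : V) : ⋀[ℂ]^2 V := exteriorPower.ιMulti ℂ 2 ![a, b]

/-- Decomposable elements of `⋀² V`. -/
def IsDecomposable (z : ⋀[ℂ]^2 V) : Prop := ∃ a b : V, z = wedge a b

/-- The condition (*) on a subspace of `⋀² V`, where `dim V = n + 1`. -/
structure ConditionStar (n : ℕ) (W : Submodule ℂ (⋀[ℂ]^2 V)) : Prop where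
  finrank_eq : (Module.finrank ℂ W : ℤ) = (n + 1).choose 2 - 2 * n + 1
  eq_zero_of_isDecomposable : ∀ z ∈ W, IsDecomposable z → z = 0

variable (V) in
/-- The bilinear map `(v, a) ↦ a ∧ v`. -/
def wedgePoint : V →ₗ[ℂ] V →ₗ[ℂ] ⋀[ℂ]^2 V :=
  have h0 : ∀ a v c : V, Function.update ![a, v] 0 c = ![c, v] := fun a v c => by
    ext i; fin_cases i <;> rfl
  have h1 : ∀ a v c : V, Function.update ![a, v] 1 c = ![a, c] := fun a v c => by
    ext i; fin_cases i <;> rfl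
  LinearMap.mk₂ ℂ (fun v a => wedge a v)
    (fun v v' a => by
      have := (exteriorPower.ιMulti ℂ 2 (M := V)).map_update_add ![a, v] 1 v v'
      rwa [h1, h1, h1] at this)
    (fun c v a => by
      have := (exteriorPower.ιMulti ℂ 2 (M := V)).map_update_smul ![a, v] 1 c v
      rwa [h1, h1] at this)
    (fun v a a' => by
      have := (exteriorPower.ιMulti ℂ 2 (M := V)).map_update_add ![a, v] 0 a a'
      rwa [h0, h0, h0] at this)
    (fun c v a => by
      have := (exteriorPower.ιMulti ℂ 2 (M := V)).map_update_smul ![a, v] 0 c a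
      rwa [h0, h0] at this)

lemma wedgePoint_smul_self (v : V) (c : ℂ) : wedgePoint V v (c • v) = 0 := by
  rw [map_smul]
  have : wedge v v = 0 := (exteriorPower.ιMulti ℂ 2 (M := V)).map_eq_zero_of_eq ![v, v]
      (i := 0) (j := 1) rfl (by decide)
  change c • wedge v v = 0
  rw [this, smul_zero]

/-- For `v ≠ 0` spanning the line `x`, the fibre at `x` of the morphism `quotientMap L` below, where
`V/x` is identified with the fibre of `Q(-1)` by means of `v`: it maps the class of `a` to
`L (a ∧ v)`. -/
def quotientMapFibre {T : Type u} [AddCommGroup T] [Module ℂ T] (L : (⋀[ℂ]^2 V) →ₗ[ℂ] T) (v : V) :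
    (V ⧸ ℂ ∙ v) →ₗ[ℂ] T :=
  (ℂ ∙ v).liftQ (L ∘ₗ wedgePoint V v) (by
    rw [Submodule.span_singleton_le_iff_mem, LinearMap.mem_ker, LinearMap.comp_apply]
    have := wedgePoint_smul_self v 1
    rw [one_smul] at this
    rw [this, map_zero])

/-- The dimension of the cokernel of `quotientMapFibre L v`. -/
def quotientMapFibreCorank {T : Type u} [AddCommGroup T] [Module ℂ T]
    (L : (⋀[ℂ]^2 V) →ₗ[ℂ] T) (v : V) : ℕ :=
  Module.finrank ℂ (T ⧸ LinearMap.range (quotientMapFibre L v))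

/-- For `v ≠ 0` spanning the line `x`, the fibre at `x` of the morphism `varpiCompl hD` below. -/
def varpiComplFibre {W D : Submodule ℂ (⋀[ℂ]^2 V)} (hD : IsCompl D W) (v : V) :
    (V ⧸ ℂ ∙ v) →ₗ[ℂ] D :=
  quotientMapFibre (T := D) (D.projectionOnto W hD) v

/-- For `v ≠ 0` spanning the line `x`, the dimension of the cokernel of the fibre at `x` of the
morphism `varpiCompl hD` below, that is the dimension of the fibre of `F(W)(1)` at `x`. -/
def tangoFibreRank {W D : Submodule ℂ (⋀[ℂ]^2 V)} (hD : IsCompl D W) (v : V) : ℕ :=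
  quotientMapFibreCorank (T := D) (D.projectionOnto W hD) v

variable [FiniteDimensional ℂ V]

variable (V) in
lemma tautological_wedge :
    tautological V (-1) ≫ tensorLinear (-1) 0 rfl (wedgePoint V) = 0 := by
  apply SheafOfModules.hom_ext
  apply PresheafOfModules.hom_ext
  intro A
  ext s
  exact Subtype.ext <| funext fun x => funext fun v => wedgePoint_smul_self v.1 _

variable (V) in
/-- The canonical morphism `Q(-1) ⟶ ⋀² V ⊗ O`, through which the morphism
`V ⊗ O(-1) ⟶ ⋀² V ⊗ O`, `s ↦ (v ↦ s(v) ∧ v)`, factors. -/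
def quotientToWedge : quotientBundle V (-1) ⟶ twisted V 0 (⋀[ℂ]^2 V) :=
  Limits.cokernel.desc _ _ (tautological_wedge V)

/-- The composite `Q(-1) ⟶ ⋀² V ⊗ O ⟶ T ⊗ O`, for a linear map `L : ⋀² V → T`. -/
def quotientMap {T : Type u} [AddCommGroup T] [Module ℂ T] (L : (⋀[ℂ]^2 V) →ₗ[ℂ] T) :
    quotientBundle V (-1) ⟶ twisted V 0 T :=
  quotientToWedge V ≫ tensorConst V 0 L

/-- The morphism `Q(-1) ⟶ (⋀² V / W) ⊗ O` attached to `W`. -/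
def varpi (W : Submodule ℂ (⋀[ℂ]^2 V)) :
    quotientBundle V (-1) ⟶ twisted V 0 ((⋀[ℂ]^2 V) ⧸ W) :=
  quotientMap W.mkQ

/-- The bundle `F(W)(1)`, where `F(W)` is the Tango bundle attached to `W`: the cokernel of
`Q(-1) ⟶ (⋀² V / W) ⊗ O`. -/
def tangoBundleTwisted (W : Submodule ℂ (⋀[ℂ]^2 V)) : SheafOfModules.{u} (structureSheaf V) :=
  Limits.cokernel (varpi W)

/-- The projection `(⋀² V / W) ⊗ O ⟶ F(W)(1)`. -/
def toTangoBundleTwisted (W : Submodule ℂ (⋀[ℂ]^2 V)) :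
    twisted V 0 ((⋀[ℂ]^2 V) ⧸ W) ⟶ tangoBundleTwisted W :=
  Limits.cokernel.π (varpi W)

/-- For a complement `D` of `W` in `⋀² V`, the morphism `Q(-1) ⟶ D ⊗ O` that corresponds to
`varpi W` under the isomorphism `D ≃ ⋀² V / W`: the composite of `Q(-1) ⟶ ⋀² V ⊗ O` with the
projection onto `D` along `W`. -/
def varpiCompl {W D : Submodule ℂ (⋀[ℂ]^2 V)} (hD : IsCompl D W) :
    quotientBundle V (-1) ⟶ twisted V 0 D :=
  quotientMap (D.projectionOnto W hD)

/-- The morphism `D ⊗ O ⟶ F(W)(1)`, composite of `D ⊗ O ⟶ (⋀² V / W) ⊗ O` (an isomorphism when `D`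
is a complement of `W`) with the projection to the cokernel of `varpi W`. -/
def complToTango (W D : Submodule ℂ (⋀[ℂ]^2 V)) : twisted V 0 D ⟶ tangoBundleTwisted W :=
  tensorConst V 0 (W.mkQ ∘ₗ D.subtype) ≫ toTangoBundleTwisted W

lemma varpiCompl_comp {W D : Submodule ℂ (⋀[ℂ]^2 V)} (hD : IsCompl D W) :
    varpiCompl hD ≫ tensorConst V 0 (W.mkQ ∘ₗ D.subtype) = varpi W := by
  have : (W.mkQ ∘ₗ D.subtype) ∘ₗ D.projectionOnto W hD = W.mkQ := by
    refine LinearMap.ext fun z => ((Submodule.Quotient.eq W).mpr ?_)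
    rw [← Submodule.projectionOnto_apply_eq_zero_iff hD, map_sub]
    exact sub_eq_zero.mpr (Submodule.projectionOnto_apply_left hD _)
  rw [varpiCompl, varpi, quotientMap, quotientMap, Category.assoc, tensorConst_comp, this]

/-- The sequence `0 ⟶ Q(-1) ⟶ D ⊗ O ⟶ F(W)(1) ⟶ 0`. -/
def tangoSequence {W D : Submodule ℂ (⋀[ℂ]^2 V)} (hD : IsCompl D W) :
    ShortComplex (SheafOfModules.{u} (structureSheaf V)) :=
  ShortComplex.mk (varpiCompl hD) (complToTango W D) (by
    rw [complToTango, ← Category.assoc, varpiCompl_comp]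
    exact Limits.cokernel.condition (varpi W))

end Tango

/-! ## The action of the one-dimensional torus on `⋀² (Sⁿ U)` -/

section Action

variable {U : Type u} [AddCommGroup U] [Module ℂ U]

variable (U) in
/-- The symmetric power `Sⁿ U`, as the part of degree `n` of the symmetric algebra of `U`. -/
def symPower (n : ℕ) : Submodule ℂ (SymmetricAlgebra ℂ U) :=
  LinearMap.range (SymmetricAlgebra.ι ℂ U) ^ n

instance (n : ℕ) [FiniteDimensional ℂ U] : FiniteDimensional ℂ (symPower U n) :=
  Module.Finite.iff_fg.mpr (Submodule.FG.pow (Module.Finite.iff_fg.mp inferInstance) n)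

/-- The endomorphism `Sⁿ g` of `Sⁿ U`. -/
def symPowerMap (n : ℕ) (g : U →ₗ[ℂ] U) : symPower U n →ₗ[ℂ] symPower U n :=
  (SymmetricAlgebra.lift (SymmetricAlgebra.ι ℂ U ∘ₗ g)).toLinearMap.restrict (by
    intro a ha
    have h : (symPower U n).map (SymmetricAlgebra.lift (SymmetricAlgebra.ι ℂ U ∘ₗ g)).toLinearMap
        ≤ symPower U n := by
      rw [symPower, Submodule.map_pow]
      refine pow_le_pow_left' ?_ n
      rintro _ ⟨_, ⟨y, rfl⟩, rfl⟩
      exact ⟨g y, by simp⟩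
    exact h ⟨a, ha, rfl⟩)

/-- The automorphism of `U` with matrix `diag(t ^ α, t ^ β)` in the basis `b`. -/
def torus (b : Module.Basis (Fin 2) ℂ U) (α β : ℤ) (t : ℂˣ) : U →ₗ[ℂ] U :=
  Matrix.toLin b b !![((t ^ α : ℂˣ) : ℂ), 0; 0, ((t ^ β : ℂˣ) : ℂ)]

variable (b : Module.Basis (Fin 2) ℂ U) (α β : ℤ) (n : ℕ)

/-- The action of `t ∈ ℂ*` on `⋀² (Sⁿ U)`. -/
def wedgeAction (t : ℂˣ) : (⋀[ℂ]^2 (symPower U n)) →ₗ[ℂ] ⋀[ℂ]^2 (symPower U n) :=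
  exteriorPower.map 2 (symPowerMap n (torus b α β t))

/-- The `ℂ*`-invariant subspaces of `⋀² (Sⁿ U)`. -/
def IsInvariant (W : Submodule ℂ (⋀[ℂ]^2 (symPower U n))) : Prop :=
  ∀ t : ℂˣ, W.map (wedgeAction b α β n t) ≤ W

/-- The weight space `E_k` of `⋀² (Sⁿ U)`: the vectors on which every `t ∈ ℂ*` acts as the
multiplication by `t ^ (2 n α + k (β - α))`. -/
def weightSpace (k : ℕ) : Submodule ℂ (⋀[ℂ]^2 (symPower U n)) :=
  ⨅ t : ℂˣ, LinearMap.ker (wedgeAction b α β n t -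
    ((t ^ (2 * n * α + k * (β - α)) : ℂˣ) : ℂ) • LinearMap.id)

/-- The set of the `ℂ*`-invariant subspaces of `⋀² (Sⁿ U)` that satisfy the condition (*). -/
def invariantSubspaces : Set (Submodule ℂ (⋀[ℂ]^2 (symPower U n))) :=
  {W | IsInvariant b α β n W ∧ ConditionStar n W}

end Action

/-- The hyperplane of `E` that corresponds to a point of `P(E*)`, as a subspace of the ambient
space of `E`. -/
def hyperplane {M : Type u} [AddCommGroup M] [Module ℂ M] {E : Submodule ℂ M}
    (H : ℙ ℂ (Module.Dual ℂ E)) : Submodule ℂ M :=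
  (LinearMap.ker H.rep).map E.subtype

end

end TangoBundle

/-! Let `e p` be the monomial basis of `Sⁿ U`, and give `e p ∧ e q` the weight `p + q`. Since `α ≠
β`, distinct weights have distinct characters, so the invariant subspaces are the graded ones
(`isInvariant_iff_isGraded`). The key point is that a graded `W` avoids all nonzero decomposable
vectors as soon as it avoids the finitely many `e p ∧ e q` (`IsGraded.forall_isDecomposable_iff`):
once `b` is reduced modulo `a`, the lowest-weight component of `a ∧ b` is a nonzero multiple of a
single basis vector.

Choose one basis vector in each weight `1, …, 2n - 1` and let `D` be their span. A graded `W`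
without basis vectors meets `D` in zero, and the dimension in (*) makes `D` a complement
(`isCompl_transversal`). Hence `W` cuts every weight space in a hyperplane (`exists_hyperplane_eq`),
which is zero in the weights `1, 2, 2n - 2, 2n - 1`, where the weight space is a line. Conversely,
hyperplanes without basis vectors in the remaining weights add up to a complement of `D`, hence have
the right total dimension (`iSup_hyperplane_mem_invariantSubspaces`). Avoiding the basis vectors of
weight `k` means that finitely many linear forms on `E_k*` do not vanish, an open condition.

The same `D` serves for the Tango sequence. If `a ∧ v` projects to zero in `D`, it lies in `W`, so
it vanishes and `a` is a multiple of `v`; this is injectivity on fibres, and the corank is `(2n - 1)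
- n`. On sheaves it makes `O(-2) ⟶ V ⊗ O(-1) ⟶ D ⊗ O` exact, so the cokernel `Q(-1)` of the first
map embeds in `D ⊗ O` (`mono_quotientMap`). -/

namespace TangoBundle

/-! ### Exactness of the sequences of sheaves -/

section SheafSequences

variable {V : Type u} [AddCommGroup V] [Module ℂ V]

/-- If a regular section of `V ⊗ O(d + 1)` is everywhere a multiple of the tautological vector,
the factor is regular of degree `d`. -/
lemma isRegular_of_smul_self (d d' : ℤ) (hd : d' = d + 1) (A : Opens (P V))
    {s : ∀ x : A, Line x.1 → V} (hs : (isRegular V d' V).pred s)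
    {c : ∀ x : A, Line x.1 → ULift.{u} ℂ} (hc : ∀ x v, s x v = (c x v).down • v.1) :
    (isRegular V d (ULift.{u} ℂ)).pred c := by
  intro x
  obtain ⟨B, hB, i, e, q, hq, hq0, h⟩ := hs x
  obtain ⟨ξ, hξ⟩ := exists_dual_ne_zero x.1.rep x.1.rep_nonzero
  have hD : IsOpen (nonvanishing V (MvPolynomial.X ξ)) :=
    TopologicalSpace.isOpen_generateFrom_of_mem ⟨1, _, MvPolynomial.isHomogeneous_X _ _, rfl⟩
  -- Where `ξ` has no zero, the factor is `ξ(s) / ξ`, so the denominator `q` of `s` is replaced by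
  -- `q * ξ`.
  refine ⟨⟨_, hD⟩ ⊓ B, ⟨?_, hB⟩, Opens.infLERight _ _ ≫ i, e + 1, q * MvPolynomial.X ξ,
    hq.mul (MvPolynomial.isHomogeneous_X _ _), ?_, fun φ => ?_⟩
  · intro v hv hvx
    rw [← x.1.mk_rep, Projectivization.mk_eq_mk_iff] at hvx
    obtain ⟨a, ha⟩ := hvx
    have : a • ξ x.1.rep = ξ v := by rw [← ha]; simp [Units.smul_def]
    simp only [polyEval, MvPolynomial.eval_X, ← this]
    simpa [Units.smul_def] using hξ
  · intro y v
    obtain ⟨h0, hv⟩ := v.2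
    have h1 := y.2.1 v.1 h0 hv
    have h2 := hq0 ⟨y.1, y.2.2⟩ v
    simp only [polyEval, map_mul] at h1 h2 ⊢
    exact mul_ne_zero h2 h1
  -- A form `φ` on the one-dimensional target is multiplication by `φ 1`, so `φ(c) ξ(v)` is the
  -- value of `φ(1) ξ` on `s`.
  · obtain ⟨e', p, he, hp, hps⟩ := h (φ ⟨1⟩ • ξ)
    refine ⟨e', p, by push_cast; omega, hp, fun y v => ?_⟩
    have h1 := hps ⟨y.1, y.2.2⟩ v
    have h2 : ∀ z : ULift.{u} ℂ, φ z = z.down * φ ⟨1⟩ := fun z => by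
      rw [← smul_eq_mul, ← map_smul]
      congr 1
      ext
      simp
    change _ * φ (c ⟨y.1, i.le y.2.2⟩ v) = _
    change _ * (φ ⟨1⟩ • ξ) (s ⟨y.1, i.le y.2.2⟩ v) = _ at h1
    rw [hc] at h1
    rw [← h1, h2]
    simp only [polyEval, map_mul, MvPolynomial.eval_X, LinearMap.smul_apply, map_smul, smul_eq_mul]
    ring

variable {T : Type u} [AddCommGroup T] [Module ℂ T]

lemma isIso_tensorConst (d : ℤ) {T' : Type u} [AddCommGroup T'] [Module ℂ T'] (L : T ≃ₗ[ℂ] T') :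
    IsIso (tensorConst V d L.toLinearMap) := by
  refine ⟨tensorConst V d L.symm.toLinearMap, ?_, ?_⟩
  · rw [tensorConst_comp, LinearEquiv.symm_comp]; rfl
  · rw [tensorConst_comp, LinearEquiv.comp_symm]; rfl

variable [FiniteDimensional ℂ V]

lemma tautological_tensorLinear (L : (⋀[ℂ]^2 V) →ₗ[ℂ] T) :
    tautological V (-1) ≫ tensorLinear (-1) 0 rfl ((wedgePoint V).compr₂ L) = 0 := by
  have : tensorLinear (-1) 0 rfl ((wedgePoint V).compr₂ L) =
      tensorLinear (-1) 0 rfl (wedgePoint V) ≫ tensorConst V 0 L := rfl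
  rw [this, ← Category.assoc, tautological_wedge, Limits.zero_comp]

/-- Injectivity on fibres forces each section in the image of `g` to be pointwise a multiple of the
tautological vector, and the factor is regular by `isRegular_of_smul_self`. This is exactness at `V
⊗ O(-1)`, tested on arbitrary sources. -/
lemma exists_lift_tautological {L : (⋀[ℂ]^2 V) →ₗ[ℂ] T}
    (hL : ∀ v : V, v ≠ 0 → ∀ a : V, L (wedge a v) = 0 → a ∈ ℂ ∙ v)
    {Y : SheafOfModules.{u} (structureSheaf V)} (g : Y ⟶ twisted V (-1) V)
    (hg : g ≫ tensorLinear (-1) 0 rfl ((wedgePoint V).compr₂ L) = 0) :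
    ∃ f : Y ⟶ twisted V (-1 - 1) (ULift.{u} ℂ), g = f ≫ tautological V (-1) := by
  -- The forms `ξ v` only read off the factor, as `ξ v (g v)`. They may depend arbitrarily on `v`,
  -- since the regularity of the factor is obtained separately.
  have hdual : ∀ v : V, ∃ ξ : Module.Dual ℂ V, v ≠ 0 → ξ v = 1 := fun v => by
    by_cases hv : v = 0
    · exact ⟨0, fun h => absurd hv h⟩
    · obtain ⟨ξ, hξ⟩ := exists_dual_ne_zero v hv
      exact ⟨(ξ v)⁻¹ • ξ, fun _ => by simp [hξ]⟩
  choose ξ hξ using hdual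
  have key : ∀ (A : (Opens (P V))ᵒᵖ) (z : Y.val.obj A) (x : A.unop) (v : Line x.1),
      (g.val.app A z).1 x v = ξ v.1 ((g.val.app A z).1 x v) • v.1 := by
    intro A z x v
    obtain ⟨h0, -⟩ := v.2
    have h1 : (g ≫ tensorLinear (-1) 0 rfl ((wedgePoint V).compr₂ L)).val.app A z = 0 := by
      rw [hg]; rfl
    have h2 : L (wedge ((g.val.app A z).1 x v) v.1) = 0 :=
      congrFun (congrFun (congrArg Subtype.val h1) x) v
    obtain ⟨c, hc⟩ := Submodule.mem_span_singleton.mp (hL _ h0 _ h2)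
    rw [← hc, map_smul, hξ _ h0, smul_eq_mul, mul_one]
  refine ⟨⟨PresheafOfModules.homMk
    { app := fun A => AddCommGrpCat.ofHom
        { toFun := fun z => ⟨fun x v => ⟨ξ v.1 ((g.val.app A z).1 x v)⟩,
            isRegular_of_smul_self _ _ (by ring) A.unop (g.val.app A z).2 (key A z)⟩
          map_zero' := ?_
          map_add' := ?_ }
      naturality := ?_ } ?_⟩, ?_⟩
  · refine Subtype.ext <| funext fun x => funext fun v => ?_
    refine (congrArg (fun s : twistedSections V (-1) V A.unop => ULift.up (ξ v.1 (s.1 x v)))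
      (map_zero (g.val.app A).hom)).trans ?_
    exact congrArg ULift.up (map_zero (ξ v.1))
  · intro z z'
    refine Subtype.ext <| funext fun x => funext fun v => ?_
    refine (congrArg (fun s : twistedSections V (-1) V A.unop => ULift.up (ξ v.1 (s.1 x v)))
      (map_add (g.val.app A).hom z z')).trans ?_
    exact congrArg ULift.up (map_add (ξ v.1) _ _)
  · intro A A' i
    ext z
    refine Subtype.ext <| funext fun x => funext fun v => ?_
    have := PresheafOfModules.naturality_apply g.val i z
    refine congrArg (fun s : twistedSections V (-1) V A'.unop => ULift.up (ξ v.1 (s.1 x v))) this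
  · intro A r z
    refine Subtype.ext <| funext fun x => funext fun v => ?_
    have := map_smul (g.val.app A).hom r z
    refine (congrArg (fun s : twistedSections V (-1) V A.unop => ULift.up (ξ v.1 (s.1 x v)))
      this).trans ?_
    exact congrArg ULift.up (map_smul (ξ v.1) (r.1 x v) _)
  · apply SheafOfModules.hom_ext
    apply PresheafOfModules.hom_ext
    intro A
    ext z
    exact Subtype.ext <| funext fun x => funext fun v => key A z x v

/-- The morphism `Q(-1) ⟶ T ⊗ O` is a monomorphism if it is injective on the fibres. -/
theorem mono_quotientMap {L : (⋀[ℂ]^2 V) →ₗ[ℂ] T}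
    (hL : ∀ v : V, v ≠ 0 → ∀ a : V, L (wedge a v) = 0 → a ∈ ℂ ∙ v) :
    Mono (quotientMap L) := by
  let S := ShortComplex.mk _ _ (tautological_tensorLinear L)
  have hS : S.Exact := by
    rw [ShortComplex.exact_iff_exact_up_to_refinements]
    intro Y g hg
    obtain ⟨f, hf⟩ := exists_lift_tautological hL g hg
    -- The lift exists on `Y` itself, so no refinement is needed.
    exact ⟨Y, 𝟙 Y, inferInstance, f, by rw [Category.id_comp]; exact hf⟩
  have h := S.exact_iff_mono_cokernel_desc.mp hS
  have : quotientMap L = Limits.cokernel.desc S.f S.g S.zero := by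
    apply Limits.coequalizer.hom_ext
    refine Eq.trans ?_ (Limits.cokernel.π_desc S.f S.g S.zero).symm
    change Limits.cokernel.π (tautological V (-1)) ≫ quotientToWedge V ≫ tensorConst V 0 L = _
    rw [quotientToWedge, ← Category.assoc, Limits.cokernel.π_desc]
    rfl
  rw [this]
  exact h

/-- The sequence `0 ⟶ Q(-1) ⟶ D ⊗ O ⟶ F(W)(1) ⟶ 0` is exact if `W` contains no nonzero
decomposable vector. -/
theorem tangoSequence_shortExact {W D : Submodule ℂ (⋀[ℂ]^2 V)} (hD : IsCompl D W)
    (hL : ∀ v : V, v ≠ 0 → ∀ a : V, D.projectionOnto W hD (wedge a v) = 0 → a ∈ ℂ ∙ v) :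
    (tangoSequence hD).ShortExact := by
  have hiso : IsIso (tensorConst V 0 (T := D) (T' := (⋀[ℂ]^2 V) ⧸ W) (W.mkQ ∘ₗ D.subtype)) := by
    have : W.mkQ ∘ₗ D.subtype = (W.quotientEquivOfIsCompl D hD.symm).symm.toLinearMap := by
      ext x
      simp
    rw [this]
    exact isIso_tensorConst 0 _
  have hmono : Mono (varpiCompl hD) := mono_quotientMap hL
  have hepi' : Epi (toTangoBundleTwisted W) := Limits.coequalizer.π_epi
  have hepi : Epi (complToTango W D) := epi_comp _ (toTangoBundleTwisted W)
  let S := ShortComplex.mk (varpi W) (toTangoBundleTwisted W) (Limits.cokernel.condition (varpi W))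
  have hS : S.Exact := ShortComplex.exact_cokernel (varpi W)
  -- Exactness in the middle is transported from the cokernel sequence of `varpi W` along `D ≃ ⋀² V
  -- / W`.
  let φ : tangoSequence hD ⟶ S :=
    { τ₁ := 𝟙 _
      τ₂ := tensorConst V 0 (T := D) (T' := (⋀[ℂ]^2 V) ⧸ W) (W.mkQ ∘ₗ D.subtype)
      τ₃ := 𝟙 _
      comm₁₂ := (Category.id_comp _).trans (varpiCompl_comp hD).symm
      comm₂₃ := (Category.comp_id _).symm }
  have h1 : IsIso φ.τ₁ := IsIso.id _
  have h2 : IsIso φ.τ₂ := hiso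
  have h3 : IsIso φ.τ₃ := IsIso.id _
  exact { exact := (ShortComplex.exact_iff_of_epi_of_isIso_of_mono φ).mpr hS
          mono_f := hmono
          epi_g := hepi }

end SheafSequences

section Components

/-! ## Homogeneous components with respect to a weighted basis -/

variable {M : Type*} [AddCommGroup M] [Module ℂ M] {I : Type*} (B : Module.Basis I ℂ M) (wt : I → ℕ)

/-- The projection to the span of the basis vectors of weight `k`. -/
noncomputable def component (k : ℕ) : M →ₗ[ℂ] M :=
  B.constr ℂ fun i => if wt i = k then B i else 0

@[simp]
lemma component_basis (k : ℕ) (i : I) : component B wt k (B i) = if wt i = k then B i else 0 :=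
  B.constr_basis ℂ _ i

lemma repr_component (k : ℕ) (z : M) (i : I) :
    B.repr (component B wt k z) i = if wt i = k then B.repr z i else 0 := by
  have : B.coord i ∘ₗ component B wt k = if wt i = k then B.coord i else 0 := by
    refine B.ext fun j => ?_
    rw [LinearMap.comp_apply, component_basis]
    rcases eq_or_ne i j with rfl | hij
    · split_ifs <;> simp
    · split_ifs <;> simp [Finsupp.single_eq_of_ne hij]
  have h := LinearMap.congr_fun this z
  split_ifs at h ⊢ with hi <;> exact h

lemma component_component (j k : ℕ) (z : M) :
    component B wt j (component B wt k z) = if j = k then component B wt k z else 0 := by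
  apply B.repr.injective
  ext i
  rw [repr_component, repr_component]
  split_ifs <;> simp_all [repr_component]

lemma component_eq_of_homogeneous {j k : ℕ} {z : M} (hz : component B wt k z = z) :
    component B wt j z = if j = k then z else 0 := by
  have := component_component B wt j k z
  rwa [hz] at this

lemma sum_component (N : ℕ) (hN : ∀ i, wt i < N) (z : M) :
    ∑ k ∈ Finset.range N, component B wt k z = z := by
  apply B.repr.injective
  ext i
  simp [repr_component, hN i]

variable {B wt} in
/-- The components of a sum of subspaces of homogeneous vectors. -/
lemma component_mem_of_mem_iSup {K : Type*} (d : K → ℕ) (A : K → Submodule ℂ M)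
    (hA : ∀ k, ∀ z ∈ A k, component B wt (d k) z = z) {z : M} (hz : z ∈ ⨆ k, A k) (j : ℕ)
    (p : Submodule ℂ M) (hp : ∀ k, d k = j → A k ≤ p) : component B wt j z ∈ p := by
  induction hz using Submodule.iSup_induction' with
  | zero => simp
  | add x y _ _ hx hy => rw [map_add]; exact p.add_mem hx hy
  | mem k x hx =>
    rw [component_eq_of_homogeneous B wt (hA k x hx)]
    split_ifs with h
    · exact hp k h.symm hx
    · exact p.zero_mem

variable {B wt} in
-- A vector of degree `d k` equals its own component of that degree, whereas a sum of vectors from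
-- the other subspaces has none there.
lemma iSupIndep_of_homogeneous {K : Type*} {d : K → ℕ} (hd : Function.Injective d)
    {A : K → Submodule ℂ M} (hA : ∀ k, ∀ z ∈ A k, component B wt (d k) z = z) : iSupIndep A := by
  intro k
  rw [Submodule.disjoint_def]
  intro z hz hz'
  rw [← hA k z hz, ← Submodule.mem_bot ℂ]
  refine component_mem_of_mem_iSup d (fun j => ⨆ _ : j ≠ k, A j) (fun j y hy => ?_) hz' _ _
    (fun j hj => ?_)
  · by_cases h : j = k
    · have : y = 0 := by simpa [h] using hy
      rw [this, map_zero]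
    · exact hA j y (by simpa [h] using hy)
  · simp [hd hj]

/-- A subspace that contains the homogeneous components of its elements. -/
def IsGraded (W : Submodule ℂ M) : Prop := ∀ k, ∀ z ∈ W, component B wt k z ∈ W

variable {B wt} in
lemma isGraded_iSup {K : Type*} (d : K → ℕ) (A : K → Submodule ℂ M)
    (hA : ∀ k, ∀ z ∈ A k, component B wt (d k) z = z) : IsGraded B wt (⨆ k, A k) :=
  fun j _ hz => component_mem_of_mem_iSup d A hA hz j _ fun k _ => le_iSup A k

/-! ### Spans of basis vectors of distinct weights as complements of graded subspaces -/

section Transversal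

variable {K : Type*} (σ : K → I)

/-- The span of a family of basis vectors. -/
def transversal : Submodule ℂ M := Submodule.span ℂ (Set.range fun k => B (σ k))

lemma isGraded_transversal : IsGraded B wt (transversal B σ) := by
  intro k z hz
  induction hz using Submodule.span_induction with
  | mem x hx =>
    obtain ⟨j, rfl⟩ := hx
    rw [component_basis]
    split_ifs
    · exact Submodule.subset_span ⟨j, rfl⟩
    · exact Submodule.zero_mem _
  | zero => simp
  | add x y _ _ hx hy => rw [map_add]; exact Submodule.add_mem _ hx hy
  | smul c x _ hx => rw [map_smul]; exact Submodule.smul_mem _ c hx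

variable {wt} (hσ : Function.Injective fun k => wt (σ k))

include hσ

/-- Only one of the spanning vectors has the weight of `σ k`. -/
lemma component_of_mem_transversal {z : M} (hz : z ∈ transversal B σ) (k : K) :
    component B wt (wt (σ k)) z = B.repr z (σ k) • B (σ k) := by
  induction hz using Submodule.span_induction with
  | mem x hx =>
    obtain ⟨j, rfl⟩ := hx
    rcases eq_or_ne j k with rfl | hjk
    · simp
    · have h1 : wt (σ j) ≠ wt (σ k) := fun h => hjk (hσ h)
      have h2 : σ k ≠ σ j := fun h => h1 (by rw [h])
      simp [h1, Finsupp.single_eq_of_ne h2]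
  | zero => simp
  | add x y _ _ hx hy => rw [map_add, hx, hy, map_add, Finsupp.add_apply, add_smul]
  | smul c x _ hx => rw [map_smul, hx, map_smul, Finsupp.smul_apply, smul_eq_mul, mul_smul]

/-- The components of a common vector stay in `W` and are multiples of single basis vectors, so all
its coordinates vanish. -/
lemma disjoint_transversal {W : Submodule ℂ M} (hW : IsGraded B wt W) (hB : ∀ i, B i ∉ W) :
    Disjoint (transversal B σ) W := by
  rw [Submodule.disjoint_def]
  intro z hz hzW
  have h0 : ∀ k, B.repr z (σ k) = 0 := fun k => by
    by_contra h
    have := hW (wt (σ k)) z hzW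
    rw [component_of_mem_transversal B σ hσ hz] at this
    exact hB _ ((W.smul_mem_iff h).mp this)
  apply B.repr.injective
  ext i
  rw [map_zero, Finsupp.zero_apply]
  by_cases hi : i ∈ Set.range σ
  · obtain ⟨k, rfl⟩ := hi
    exact h0 k
  · have : z ∈ Submodule.span ℂ (B '' Set.range σ) := by
      rwa [← Set.range_comp]
    by_contra h
    exact hi (Module.Basis.mem_span_image B |>.mp this (Finsupp.mem_support_iff.mpr h))

lemma finrank_transversal [Fintype K] :
    Module.finrank ℂ (transversal B σ) = Fintype.card K := by
  have : Function.Injective σ := fun j k h => hσ (congrArg wt h)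
  exact finrank_span_eq_card (B.linearIndependent.comp σ this)

/-- The coordinates, with respect to `B`, of the projection to the transversal along `W` cut out
the homogeneous parts of `W`. -/
lemma mem_iff_repr_projection_eq_zero {W : Submodule ℂ M} (hW : IsGraded B wt W)
    (hc : IsCompl (transversal B σ) W) {k : K} {z : M} (hz : component B wt (wt (σ k)) z = z) :
    z ∈ W ↔ B.repr ((transversal B σ).projectionOnto W hc z : M) (σ k) = 0 := by
  constructor
  · intro h
    rw [(Submodule.projectionOnto_apply_eq_zero_iff hc).mpr h]
    simp
  · intro h
    -- Take the component of this difference in the weight of `σ k`: the projection contributes only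
    -- its coordinate at `σ k`, which is zero, and `z` is left.
    have h1 : z - ((transversal B σ).projectionOnto W hc z : M) ∈ W := by
      rw [← Submodule.projectionOnto_apply_eq_zero_iff hc, map_sub]
      exact sub_eq_zero.mpr (Submodule.projectionOnto_apply_left hc _).symm
    have h2 := hW (wt (σ k)) _ h1
    rwa [map_sub, hz, component_of_mem_transversal B σ hσ (SetLike.coe_mem _), h, zero_smul,
      sub_zero] at h2

end Transversal

end Components

section Wedge

/-! ## Decomposable bivectors in coordinates -/

variable {V : Type u} [AddCommGroup V] [Module ℂ V]

lemma wedge_self (a : V) : wedge a a = 0 := by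
  have := wedgePoint_smul_self a 1
  rwa [one_smul] at this

lemma wedge_sub_smul (a b : V) (c : ℂ) : wedge a (b - c • a) = wedge a b := by
  have h : wedgePoint V (b - c • a) a = wedgePoint V b a - c • wedgePoint V a a := by
    rw [map_sub, map_smul]; rfl
  have h0 : wedgePoint V a a = 0 := wedge_self a
  rw [h0, smul_zero, sub_zero] at h
  exact h

lemma wedge_swap (a b : V) : wedge b a = -wedge a b := by
  have h : wedgePoint V (a + b) (a + b) =
      wedgePoint V a a + wedgePoint V b a + (wedgePoint V a b + wedgePoint V b b) := by
    rw [map_add, map_add, LinearMap.add_apply, LinearMap.add_apply]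
  have h0 : ∀ c, wedgePoint V c c = 0 := wedge_self
  rw [h0, h0, h0, zero_add, add_zero] at h
  exact eq_neg_of_add_eq_zero_right h.symm

variable {n : ℕ} (e : Module.Basis (Fin (n + 1)) ℂ V)

/-- The basis of `⋀² V` formed by the wedges of the vectors of a basis of `V`. -/
noncomputable def wedgeBasis : Module.Basis (Fin 2 ↪o Fin (n + 1)) ℂ (⋀[ℂ]^2 V) :=
  (e.exteriorPower 2).reindex Set.powersetCard.ofFinEmbEquiv.symm

lemma wedgeBasis_apply (i : Fin 2 ↪o Fin (n + 1)) :
    wedgeBasis e i = wedge (e (i 0)) (e (i 1)) := by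
  rw [wedgeBasis, Module.Basis.reindex_apply, Equiv.symm_symm, exteriorPower.basis_apply,
    exteriorPower.ιMulti_family, Equiv.symm_apply_apply, wedge]
  congr 1
  ext j
  fin_cases j <;> rfl

lemma repr_wedge (a b : V) (i : Fin 2 ↪o Fin (n + 1)) :
    (wedgeBasis e).repr (wedge a b) i =
      e.repr a (i 0) * e.repr b (i 1) - e.repr a (i 1) * e.repr b (i 0) := by
  rw [wedgeBasis, Module.Basis.repr_reindex_apply, Equiv.symm_symm, exteriorPower.basis_repr_apply,
    wedge, exteriorPower.ιMultiDual_apply_ιMulti, Matrix.det_fin_two]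
  simp

/-- The weight of `e p ∧ e q` is `p + q`. -/
def weight (i : Fin 2 ↪o Fin (n + 1)) : ℕ := i 0 + i 1

/-- The pair `p < q` as an index of `wedgeBasis`. -/
def pair {p q : Fin (n + 1)} (h : p < q) : Fin 2 ↪o Fin (n + 1) :=
  OrderEmbedding.ofStrictMono ![p, q] (by
    intro i j hij
    fin_cases i <;> fin_cases j <;> simp_all)

lemma pair_zero {p q : Fin (n + 1)} (h : p < q) : pair h 0 = p := rfl

lemma pair_one {p q : Fin (n + 1)} (h : p < q) : pair h 1 = q := rfl

lemma index_lt (i : Fin 2 ↪o Fin (n + 1)) : (i 0 : ℕ) < i 1 := i.strictMono (by decide)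

lemma index_ext {i j : Fin 2 ↪o Fin (n + 1)} (h0 : (i 0 : ℕ) = j 0) (h1 : (i 1 : ℕ) = j 1) :
    i = j := by
  ext k
  fin_cases k
  · exact h0
  · exact h1

lemma weight_mem_Icc (i : Fin 2 ↪o Fin (n + 1)) : weight i ∈ Finset.Icc 1 (2 * n - 1) := by
  have := index_lt i
  have := (i 1).2
  rw [Finset.mem_Icc, weight]
  omega

lemma exists_weight_eq {k : ℕ} (hk : k ∈ Finset.Icc 1 (2 * n - 1)) :
    ∃ i : Fin 2 ↪o Fin (n + 1), weight i = k := by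
  rw [Finset.mem_Icc] at hk
  by_cases h : k ≤ n
  · refine ⟨pair (p := ⟨0, by omega⟩) (q := ⟨k, by omega⟩) (Fin.mk_lt_mk.mpr (by omega)), ?_⟩
    simp [weight, pair_zero, pair_one]
  · refine ⟨pair (p := ⟨k - n, by omega⟩) (q := ⟨n, by omega⟩) (Fin.mk_lt_mk.mpr (by omega)), ?_⟩
    simp only [weight, pair_zero, pair_one]
    omega

/-- The weights that occur outside the range are among `1, 2, 2n - 2, 2n - 1`, each a sum `p + q`
with `p < q ≤ n` in only one way. -/
lemma eq_of_weight_eq_of_notMem {i j : Fin 2 ↪o Fin (n + 1)} (h : weight i = weight j)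
    (hi : weight i ∉ Finset.Icc 3 (2 * n - 3)) : i = j := by
  have := index_lt i
  have := index_lt j
  have := (i 1).2
  have := (j 1).2
  rw [Finset.mem_Icc, weight] at hi
  rw [weight, weight] at h
  exact index_ext (by omega) (by omega)

lemma mem_span_of_wedge_eq_zero (e : Module.Basis (Fin (n + 1)) ℂ V) {a v : V} (hv : v ≠ 0) (h : wedge a v = 0) : a ∈ ℂ ∙ v := by
  obtain ⟨p, hp⟩ : ∃ p, e.repr v p ≠ 0 := by
    by_contra! h0
    exact hv (e.repr.injective (by ext p; simp [h0 p]))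
  -- The coordinates of `a ∧ v` are the `2 × 2` minors of the pair, so their vanishing is
  -- proportionality.
  have key : ∀ q, e.repr a p * e.repr v q = e.repr a q * e.repr v p := fun q => by
    rcases lt_trichotomy p q with hpq | rfl | hpq
    · have := repr_wedge e a v (pair hpq)
      rw [h, pair_zero, pair_one, map_zero, Finsupp.zero_apply] at this
      exact (sub_eq_zero.mp this.symm)
    · rfl
    · have := repr_wedge e a v (pair hpq)
      rw [h, pair_zero, pair_one, map_zero, Finsupp.zero_apply] at this
      exact (sub_eq_zero.mp this.symm).symm
  refine Submodule.mem_span_singleton.mpr ⟨e.repr a p / e.repr v p, e.repr.injective ?_⟩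
  ext q
  rw [map_smul, Finsupp.smul_apply, smul_eq_mul, div_mul_eq_mul_div, key, mul_div_cancel_right₀ _ hp]

/-- Any other pair of the same weight has its first index below `p`, where both vectors vanish, or
both indices below `q`, where `b` vanishes. Either way its minor is zero. -/
lemma component_wedge_of_lt {a b : V} {p q : Fin (n + 1)} (hpq : p < q)
    (ha : ∀ j < p, e.repr a j = 0) (hb : ∀ j < q, e.repr b j = 0) :
    component (wedgeBasis e) weight (weight (pair hpq)) (wedge a b) =
      (e.repr a p * e.repr b q) • wedgeBasis e (pair hpq) := by
  apply (wedgeBasis e).repr.injective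
  ext i
  rw [repr_component, repr_wedge, map_smul, Finsupp.smul_apply, Module.Basis.repr_self, smul_eq_mul]
  have hi := index_lt i
  rcases eq_or_ne i (pair hpq) with rfl | hne
  · rw [if_pos rfl, Finsupp.single_eq_same, pair_zero, pair_one, hb p hpq]
    ring
  · rw [Finsupp.single_eq_of_ne hne, mul_zero, ite_eq_right_iff]
    intro hw
    simp only [weight, pair_zero, pair_one] at hw
    have h0 : (i 0 : ℕ) ≠ p := fun h => hne (index_ext h (by rw [pair_one]; omega))
    have hlt : (p : ℕ) < q := hpq
    rcases lt_or_gt_of_ne h0 with h | h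
    · rw [ha (i 0) h, hb (i 0) (Fin.lt_def.mpr (by omega))]
      ring
    · rw [hb (i 1) (Fin.lt_def.mpr (by omega)), hb (i 0) (Fin.lt_def.mpr (by omega))]
      ring

lemma exists_minimal_repr {b : V} (hb : b ≠ 0) :
    ∃ q, e.repr b q ≠ 0 ∧ ∀ j < q, e.repr b j = 0 := by
  have h : (e.repr b).support.Nonempty := by
    rw [Finsupp.support_nonempty_iff]
    simpa using hb
  refine ⟨(e.repr b).support.min' h, Finsupp.mem_support_iff.mp (Finset.min'_mem _ h),
    fun j hj => ?_⟩
  by_contra h0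
  exact absurd (Finset.min'_le _ j (Finsupp.mem_support_iff.mpr h0)) (not_le.mpr hj)

lemma exists_component_wedge_of_ne_zero {a b : V} {p : Fin (n + 1)} (h : wedge a b ≠ 0)
    (hp : e.repr a p ≠ 0) (ha : ∀ j < p, e.repr a j = 0) (hb : ∀ j < p, e.repr b j = 0) :
    ∃ i, ∃ c : ℂ, c ≠ 0 ∧
      component (wedgeBasis e) weight (weight i) (wedge a b) = c • wedgeBasis e i := by
  -- Subtracting this multiple of `a` leaves the wedge unchanged and moves the leading index of the
  -- second vector strictly beyond `p`.
  let b' := b - (e.repr b p / e.repr a p) • a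
  have hb' : ∀ j ≤ p, e.repr b' j = 0 := by
    intro j hj
    simp only [b', map_sub, map_smul, Finsupp.sub_apply, Finsupp.smul_apply, smul_eq_mul]
    rcases hj.lt_or_eq with hj | rfl
    · rw [ha j hj, hb j hj]; ring
    · rw [div_mul_cancel₀ _ hp, sub_self]
  rw [← wedge_sub_smul a b (e.repr b p / e.repr a p)] at h ⊢
  have h0 : b' ≠ 0 := by
    rintro h0
    refine h (Eq.trans (congrArg (wedge a) h0) ?_)
    exact LinearMap.congr_fun (map_zero (wedgePoint V)) a
  obtain ⟨q, hq, hqmin⟩ := exists_minimal_repr e h0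
  have hpq : p < q := lt_of_not_ge fun hqp => hq (hb' q hqp)
  exact ⟨pair hpq, _, mul_ne_zero hp hq, component_wedge_of_lt e hpq ha hqmin⟩

/-- Some homogeneous component of a nonzero decomposable bivector is a multiple of a basis
vector. -/
theorem exists_component_eq_smul {z : ⋀[ℂ]^2 V} (hz : IsDecomposable z) (h0 : z ≠ 0) :
    ∃ i, ∃ c : ℂ, c ≠ 0 ∧
      component (wedgeBasis e) weight (weight i) z = c • wedgeBasis e i := by
  obtain ⟨a, b, rfl⟩ := hz
  have ha : a ≠ 0 := by
    rintro rfl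
    exact h0 (map_zero (wedgePoint V b))
  have hb : b ≠ 0 := by
    rintro rfl
    exact h0 (LinearMap.congr_fun (map_zero (wedgePoint V)) a)
  obtain ⟨p, hp, hpmin⟩ := exists_minimal_repr e ha
  obtain ⟨q, hq, hqmin⟩ := exists_minimal_repr e hb
  rcases le_total p q with hpq | hpq
  · exact exists_component_wedge_of_ne_zero e h0 hp hpmin fun j hj => hqmin j (hj.trans_le hpq)
  · rw [wedge_swap b a] at h0 ⊢
    obtain ⟨i, c, hc, h⟩ := exists_component_wedge_of_ne_zero e (neg_ne_zero.mp h0) hq hqmin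
      fun j hj => hpmin j (hj.trans_le hpq)
    exact ⟨i, -c, neg_ne_zero.mpr hc, by rw [map_neg, h]; exact (neg_smul _ _).symm⟩

lemma isDecomposable_wedgeBasis (i : Fin 2 ↪o Fin (n + 1)) : IsDecomposable (wedgeBasis e i) :=
  ⟨_, _, wedgeBasis_apply e i⟩

/-- A graded subspace of `⋀² V` contains no nonzero decomposable vector if and only if it contains
no vector of the basis. -/
lemma IsGraded.forall_isDecomposable_iff {W : Submodule ℂ (⋀[ℂ]^2 V)}
    (hW : IsGraded (wedgeBasis e) weight W) :
    (∀ z ∈ W, IsDecomposable z → z = 0) ↔ ∀ i, wedgeBasis e i ∉ W := by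
  constructor
  · intro h i hi
    exact (wedgeBasis e).ne_zero i (h _ hi (isDecomposable_wedgeBasis e i))
  · intro h z hz hd
    by_contra h0
    obtain ⟨i, c, hc, hi⟩ := exists_component_eq_smul e hd h0
    have := hW (weight i) z hz
    rw [hi] at this
    exact h i ((W.smul_mem_iff hc).mp this)

end Wedge

section TorusAction

/-! ## The weights of the torus on `⋀² (Sⁿ U)` -/

variable {U : Type u} [AddCommGroup U] [Module ℂ U] (b : Module.Basis (Fin 2) ℂ U)

/-- The monomial `x ^ (n - p) * y ^ p`. -/
noncomputable def monomial (n : ℕ) (p : Fin (n + 1)) : SymmetricAlgebra ℂ U :=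
  SymmetricAlgebra.ι ℂ U (b 0) ^ (n - p : ℕ) * SymmetricAlgebra.ι ℂ U (b 1) ^ (p : ℕ)

/-- These are distinct members of the monomial basis of the symmetric algebra: the exponent of the
second variable recovers `p`. -/
lemma linearIndependent_monomial (n : ℕ) : LinearIndependent ℂ (monomial b n) := by
  have h : monomial b n = b.symmetricAlgebra ∘ fun p : Fin (n + 1) =>
      Finsupp.single 0 (n - p : ℕ) + Finsupp.single 1 (p : ℕ) := by
    funext p
    have hX : MvPolynomial.monomial (Finsupp.single 0 (n - p : ℕ) + Finsupp.single 1 (p : ℕ)) 1 =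
        (MvPolynomial.X 0 ^ (n - p : ℕ) * MvPolynomial.X 1 ^ (p : ℕ) : MvPolynomial (Fin 2) ℂ) := by
      rw [MvPolynomial.X_pow_eq_monomial, MvPolynomial.X_pow_eq_monomial, MvPolynomial.monomial_mul,
        one_mul]
    rw [Function.comp_apply, Module.Basis.symmetricAlgebra, Module.Basis.map_apply,
      MvPolynomial.coe_basisMonomials]
    beta_reduce
    rw [hX]
    simp [monomial]
  rw [h]
  refine b.symmetricAlgebra.linearIndependent.comp _ fun p q hpq => Fin.ext ?_
  simpa using DFunLike.congr_fun hpq 1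

lemma span_monomial (n : ℕ) : Submodule.span ℂ (Set.range (monomial b n)) = symPower U n := by
  apply le_antisymm
  · rw [Submodule.span_le]
    rintro _ ⟨p, rfl⟩
    have h : (n - p : ℕ) + p = n := by omega
    have := Submodule.mul_mem_mul
      (Submodule.pow_mem_pow (LinearMap.range (SymmetricAlgebra.ι ℂ U)) ⟨b 0, rfl⟩ (n - p : ℕ))
      (Submodule.pow_mem_pow (LinearMap.range (SymmetricAlgebra.ι ℂ U)) ⟨b 1, rfl⟩ (p : ℕ))
    rwa [← pow_add, h] at this
  · induction n with
    | zero =>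
      rw [symPower, pow_zero, Submodule.one_le]
      exact Submodule.subset_span ⟨0, by simp [monomial]⟩
    | succ n ih =>
      have hι : LinearMap.range (SymmetricAlgebra.ι ℂ U) =
          Submodule.span ℂ (Set.range (SymmetricAlgebra.ι ℂ U ∘ b)) := by
        rw [Set.range_comp, Submodule.span_image, b.span_eq, Submodule.map_top]
      rw [symPower, pow_succ]
      refine (mul_le_mul' ih hι.le).trans ?_
      rw [Submodule.span_mul_span, Submodule.span_le]
      rintro _ ⟨_, ⟨p, rfl⟩, _, ⟨i, rfl⟩, rfl⟩
      refine Submodule.subset_span ?_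
      have hp : n + 1 - p = n - p + 1 := by omega
      fin_cases i
      · refine ⟨p.castSucc, ?_⟩
        simp only [monomial, Fin.val_castSucc, hp, Function.comp_apply, pow_succ]
        exact mul_right_comm _ _ _
      · refine ⟨p.succ, ?_⟩
        simp only [monomial, Fin.val_succ, Nat.add_sub_add_right, Function.comp_apply, pow_succ]
        exact (mul_assoc _ _ _).symm

/-- The basis of `Sⁿ U` formed by the monomials. -/
noncomputable def symBasis (n : ℕ) : Module.Basis (Fin (n + 1)) ℂ (symPower U n) :=
  (Module.Basis.span (linearIndependent_monomial b n)).map (LinearEquiv.ofEq _ _ (span_monomial b n))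

lemma coe_symBasis (n : ℕ) (p : Fin (n + 1)) :
    (symBasis b n p : SymmetricAlgebra ℂ U) = monomial b n p := by
  simp [symBasis, Module.Basis.span_apply]

variable (α β : ℤ) (n : ℕ)

lemma torus_zero (t : ℂˣ) : torus b α β t (b 0) = ((t ^ α : ℂˣ) : ℂ) • b 0 := by
  simp [torus, Matrix.toLin_self]

lemma torus_one (t : ℂˣ) : torus b α β t (b 1) = ((t ^ β : ℂˣ) : ℂ) • b 1 := by
  simp [torus, Matrix.toLin_self]

lemma symPowerMap_torus (t : ℂˣ) (p : Fin (n + 1)) :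
    symPowerMap n (torus b α β t) (symBasis b n p) =
      ((t ^ (n * α + p * (β - α)) : ℂˣ) : ℂ) • symBasis b n p := by
  apply Subtype.ext
  rw [symPowerMap, LinearMap.coe_restrict_apply, Submodule.coe_smul, coe_symBasis, monomial]
  have h0 := torus_zero b α β t
  have h1 := torus_one b α β t
  simp only [AlgHom.toLinearMap_apply, map_mul, map_pow, SymmetricAlgebra.lift_ι_apply,
    LinearMap.comp_apply, h0, h1, map_smul, smul_pow, smul_mul_smul_comm]
  congr 1
  have h : (n : ℤ) * α + p * (β - α) = α * (n - p : ℕ) + β * (p : ℕ) := by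
    rw [Nat.cast_sub (by omega)]
    ring
  rw [h, zpow_add, zpow_mul, zpow_mul]
  simp

/-- The character by which `t` acts on the weight space `E_k`. -/
noncomputable def character (k : ℕ) (t : ℂˣ) : ℂ :=
  ((t ^ (2 * n * α + k * (β - α)) : ℂˣ) : ℂ)

lemma wedgeAction_wedgeBasis (t : ℂˣ) (i : Fin 2 ↪o Fin (n + 1)) :
    wedgeAction b α β n t (wedgeBasis (symBasis b n) i) =
      character α β n (weight i) t • wedgeBasis (symBasis b n) i := by
  have hsmul : ∀ (c d : ℂ) (v v' : symPower U n), wedge (c • v) (d • v') = (c * d) • wedge v v' := by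
    intro c d v v'
    change wedgePoint _ (d • v') (c • v) = (c * d) • wedgePoint _ v' v
    rw [map_smul, map_smul, LinearMap.smul_apply, smul_smul]
  have hmap : ∀ v v' : symPower U n, wedgeAction b α β n t (wedge v v') =
      wedge (symPowerMap n (torus b α β t) v) (symPowerMap n (torus b α β t) v') := by
    intro v v'
    rw [wedgeAction, wedge, exteriorPower.map_apply_ιMulti, wedge]
    congr 1
    ext j
    fin_cases j <;> rfl
  rw [wedgeBasis_apply, hmap, symPowerMap_torus, symPowerMap_torus, hsmul, character,
    ← Units.val_mul, ← zpow_add]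
  have h : (n * α + (i 0 : ℕ) * (β - α) + (n * α + (i 1 : ℕ) * (β - α)) : ℤ) =
      2 * n * α + (weight i : ℕ) * (β - α) := by
    rw [weight]
    push_cast
    ring
  rw [h]

lemma repr_wedgeAction (t : ℂˣ) (z : ⋀[ℂ]^2 (symPower U n)) (i : Fin 2 ↪o Fin (n + 1)) :
    (wedgeBasis (symBasis b n)).repr (wedgeAction b α β n t z) i =
      character α β n (weight i) t * (wedgeBasis (symBasis b n)).repr z i := by
  have : (wedgeBasis (symBasis b n)).coord i ∘ₗ wedgeAction b α β n t =
      character α β n (weight i) t • (wedgeBasis (symBasis b n)).coord i := by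
    refine (wedgeBasis (symBasis b n)).ext fun j => ?_
    rw [LinearMap.comp_apply, wedgeAction_wedgeBasis]
    rcases eq_or_ne i j with rfl | hij
    · simp
    · simp [Finsupp.single_eq_of_ne hij]
  exact LinearMap.congr_fun this z

lemma wedgeAction_eq_sum (t : ℂˣ) (z : ⋀[ℂ]^2 (symPower U n)) :
    wedgeAction b α β n t z = ∑ k ∈ Finset.range (2 * n),
      character α β n k t • component (wedgeBasis (symBasis b n)) weight k z := by
  apply (wedgeBasis (symBasis b n)).repr.injective
  ext i
  have := Finset.mem_Icc.mp (weight_mem_Icc i)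
  rw [repr_wedgeAction]
  simp [repr_component, show weight i < 2 * n by omega]

variable {α β} (hαβ : α ≠ β)

include hαβ

/-- The element `t = 2` already separates the weights, not being a root of unity; norms reduce the
comparison of its powers to the reals. -/
lemma character_injective :
    Function.Injective fun k => character α β n k (Units.mk0 2 two_ne_zero) := by
  intro j k h
  have h2 : ((2 : ℝ) ^ (2 * n * α + j * (β - α))) = (2 : ℝ) ^ (2 * n * α + k * (β - α)) := by
    have h' : ((2 : ℂ) ^ (2 * n * α + j * (β - α))) = (2 : ℂ) ^ (2 * n * α + k * (β - α)) := by
      simpa [character] using h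
    simpa [norm_zpow] using congrArg norm h'
  have h3 := zpow_right_injective₀ (by norm_num : (0 : ℝ) < 2) (by norm_num) h2
  have h4 : ((j : ℤ) - k) * (β - α) = 0 := by linarith
  rcases mul_eq_zero.mp h4 with h5 | h5
  · omega
  · exact absurd (by linarith) hαβ

lemma mem_weightSpace_iff (k : ℕ) (z : ⋀[ℂ]^2 (symPower U n)) :
    z ∈ weightSpace b α β n k ↔ component (wedgeBasis (symBasis b n)) weight k z = z := by
  have hmem : z ∈ weightSpace b α β n k ↔
      ∀ t, wedgeAction b α β n t z = character α β n k t • z := by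
    simp [weightSpace, Submodule.mem_iInf, sub_eq_zero, character]
  rw [hmem]
  constructor
  · intro h
    apply (wedgeBasis (symBasis b n)).repr.injective
    ext i
    rw [repr_component]
    split_ifs with hi
    · rfl
    · have h1 := repr_wedgeAction b α β n (Units.mk0 2 two_ne_zero) z i
      rw [h, map_smul, Finsupp.smul_apply, smul_eq_mul] at h1
      by_contra h0
      exact hi (character_injective n hαβ (mul_right_cancel₀ (Ne.symm h0) h1).symm)
  · intro h t
    apply (wedgeBasis (symBasis b n)).repr.injective
    ext i
    rw [repr_wedgeAction, map_smul, Finsupp.smul_apply, smul_eq_mul, ← h, repr_component]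
    split_ifs with hi
    · rw [hi]
    · simp

/-- The action of `t = 2` has different eigenvalues on different weights, so each weight projection
is a polynomial in it by Lagrange interpolation. Conversely, each `t` acts by a combination of the
weight projections. -/
lemma isInvariant_iff_isGraded (W : Submodule ℂ (⋀[ℂ]^2 (symPower U n))) :
    IsInvariant b α β n W ↔ IsGraded (wedgeBasis (symBasis b n)) weight W := by
  constructor
  · intro h k z hz
    have hpoly : ∀ (Q : Polynomial ℂ), ∀ y ∈ W,
        Polynomial.aeval (wedgeAction b α β n (Units.mk0 2 two_ne_zero)) Q y ∈ W := by
      intro Q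
      induction Q using Polynomial.induction_on with
      | C c => intro y hy; simpa using W.smul_mem c hy
      | add Q R hQ hR => intro y hy; simpa using W.add_mem (hQ y hy) (hR y hy)
      | monomial m c ih =>
        intro y hy
        rw [pow_succ, ← mul_assoc, map_mul, Polynomial.aeval_X]
        exact ih _ (h _ ⟨y, hy, rfl⟩)
    let χ := fun k => character α β n k (Units.mk0 2 two_ne_zero)
    -- The nodes run up to `2 * n + k` so that `k` is among them even when it is not a weight that
    -- occurs.
    have hcomp : component (wedgeBasis (symBasis b n)) weight k =
        Polynomial.aeval (wedgeAction b α β n (Units.mk0 2 two_ne_zero))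
          (Lagrange.basis (Finset.range (2 * n + k + 1)) χ k) := by
      refine (wedgeBasis (symBasis b n)).ext fun i => ?_
      have hi := Finset.mem_Icc.mp (weight_mem_Icc i)
      rw [Module.End.aeval_apply_of_hasEigenvector (μ := χ (weight i))
        ⟨Module.End.mem_eigenspace_iff.mpr (wedgeAction_wedgeBasis b α β n _ i),
          (wedgeBasis (symBasis b n)).ne_zero i⟩, component_basis]
      split_ifs with hk
      · rw [hk, Lagrange.eval_basis_self (character_injective n hαβ).injOn
          (Finset.mem_range.mpr (by omega)), one_smul]
      · rw [Lagrange.eval_basis_of_ne (Ne.symm hk) (Finset.mem_range.mpr (by omega)), zero_smul]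
    rw [hcomp]
    exact hpoly _ z hz
  · rintro h t _ ⟨z, hz, rfl⟩
    rw [wedgeAction_eq_sum]
    exact W.sum_mem fun k _ => W.smul_mem _ (h k z hz)

end TorusAction

section Hyperplanes

/-! ## Hyperplanes of the weight spaces -/

section General

variable {M : Type u} [AddCommGroup M] [Module ℂ M]

lemma mem_hyperplane {E : Submodule ℂ M} {H : ℙ ℂ (Module.Dual ℂ E)} {z : M} :
    z ∈ hyperplane H ↔ ∃ hz : z ∈ E, H.rep ⟨z, hz⟩ = 0 := by
  simp [hyperplane]

lemma sub_div_smul_mem_hyperplane {E : Submodule ℂ M} {H : ℙ ℂ (Module.Dual ℂ E)} {x y : M}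
    (hx : x ∈ E) (hy : y ∈ E) (h : H.rep ⟨y, hy⟩ ≠ 0) :
    x - (H.rep ⟨x, hx⟩ / H.rep ⟨y, hy⟩) • y ∈ hyperplane H := by
  refine mem_hyperplane.mpr ⟨E.sub_mem hx (E.smul_mem _ hy), ?_⟩
  have : H.rep (⟨x, hx⟩ - (H.rep ⟨x, hx⟩ / H.rep ⟨y, hy⟩) • ⟨y, hy⟩) = 0 := by
    rw [map_sub, map_smul, smul_eq_mul, div_mul_cancel₀ _ h, sub_self]
  exact this

lemma mk_rep_apply_eq_zero_iff {E : Submodule ℂ M} (f : Module.Dual ℂ E) (hf : f ≠ 0) (z : E) :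
    (Projectivization.mk ℂ f hf).rep z = 0 ↔ f z = 0 := by
  obtain ⟨a, ha⟩ := Projectivization.exists_smul_eq_mk_rep ℂ f hf
  rw [← ha]
  simp [Units.smul_def]

/-- The set is the nonvanishing locus of one homogeneous polynomial, the product of the evaluations
at the `w j`. -/
lemma isOpen_setOf_rep_ne_zero {E : Submodule ℂ M} {J : Type*} [Finite J] (w : J → E) :
    IsOpen {H : ℙ ℂ (Module.Dual ℂ E) | ∀ j, H.rep (w j) ≠ 0} := by
  have := Fintype.ofFinite J
  refine TopologicalSpace.isOpen_generateFrom_of_mem ⟨∑ _ : J, 1,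
    ∏ j, MvPolynomial.X (Module.Dual.eval ℂ E (w j)),
    MvPolynomial.IsHomogeneous.prod _ _ _ fun j _ => MvPolynomial.isHomogeneous_X _ _, ?_⟩
  have hp : ∀ f : Module.Dual ℂ E, polyEval (∏ j, MvPolynomial.X (Module.Dual.eval ℂ E (w j))) f ≠ 0
      ↔ ∀ j, f (w j) ≠ 0 := fun f => by
    simp [polyEval, map_prod, Finset.prod_ne_zero_iff]
  ext H
  constructor
  · rintro h f hf rfl
    exact (hp f).mpr fun j h0 => h j ((mk_rep_apply_eq_zero_iff f hf _).mpr h0)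
  · intro h
    exact (hp _).mp (h H.rep H.rep_nonzero H.mk_rep)

/-! ### Injectivity and corank on the fibres -/

section Fibres

variable {T : Type u} [AddCommGroup T] [Module ℂ T] {L : (⋀[ℂ]^2 M) →ₗ[ℂ] T} {v : M}

lemma quotientMapFibre_injective (hL : ∀ a : M, L (wedge a v) = 0 → a ∈ ℂ ∙ v) :
    Function.Injective (quotientMapFibre L v) := by
  rw [← LinearMap.ker_eq_bot, quotientMapFibre, Submodule.ker_liftQ_eq_bot]
  exact fun a ha => hL a ha

lemma quotientMapFibreCorank_add [FiniteDimensional ℂ M] [FiniteDimensional ℂ T] (hv : v ≠ 0)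
    (h : Function.Injective (quotientMapFibre L v)) :
    quotientMapFibreCorank L v + Module.finrank ℂ M = Module.finrank ℂ T + 1 := by
  have h1 := Submodule.finrank_quotient_add_finrank (LinearMap.range (quotientMapFibre L v))
  have h2 := Submodule.finrank_quotient_add_finrank (ℂ ∙ v)
  rw [LinearMap.finrank_range_of_inj h] at h1
  rw [finrank_span_singleton hv] at h2
  rw [quotientMapFibreCorank]
  omega

variable {W D : Submodule ℂ (⋀[ℂ]^2 M)} (hD : IsCompl D W)

lemma varpiComplFibre_injective
    (hL : ∀ a : M, D.projectionOnto W hD (wedge a v) = 0 → a ∈ ℂ ∙ v) :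
    Function.Injective (varpiComplFibre hD v) :=
  quotientMapFibre_injective (T := D) hL

lemma tangoFibreRank_add [FiniteDimensional ℂ M] (hv : v ≠ 0)
    (h : Function.Injective (varpiComplFibre hD v)) :
    tangoFibreRank hD v + Module.finrank ℂ M = Module.finrank ℂ D + 1 :=
  quotientMapFibreCorank_add (T := D) hv h

end Fibres

variable {I : Type*} {B : Module.Basis I ℂ M} {wt : I → ℕ}

lemma isGraded_of_homogeneous {k : ℕ} {A : Submodule ℂ M}
    (hA : ∀ z ∈ A, component B wt k z = z) : IsGraded B wt A := by
  intro j z hz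
  rw [component_eq_of_homogeneous B wt (hA z hz)]
  split_ifs
  · exact hz
  · exact A.zero_mem

end General

variable {U : Type u} [AddCommGroup U] [Module ℂ U] (b : Module.Basis (Fin 2) ℂ U)
  {α β : ℤ} (hαβ : α ≠ β) {n : ℕ}

include hαβ

lemma wedgeBasis_mem_weightSpace {k : ℕ} {i : Fin 2 ↪o Fin (n + 1)} (hi : weight i = k) :
    wedgeBasis (symBasis b n) i ∈ weightSpace b α β n k := by
  rw [mem_weightSpace_iff b n hαβ, component_basis, if_pos hi]

lemma component_of_mem_hyperplane {k : ℕ} {H : ℙ ℂ (Module.Dual ℂ (weightSpace b α β n k))}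
    {z : ⋀[ℂ]^2 (symPower U n)} (hz : z ∈ hyperplane H) :
    component (wedgeBasis (symBasis b n)) weight k z = z :=
  (mem_weightSpace_iff b n hαβ k z).mp (mem_hyperplane.mp hz).1

/-- A hyperplane of one weight space is graded, so only basis vectors have to be excluded, and those
of other weights are not in the weight space. This turns the condition into finitely many linear
inequations on `H`. -/
lemma forall_isDecomposable_hyperplane_iff {k : ℕ}
    (H : ℙ ℂ (Module.Dual ℂ (weightSpace b α β n k))) :
    (∀ z ∈ hyperplane H, IsDecomposable z → z = 0) ↔
      ∀ i : {i : Fin 2 ↪o Fin (n + 1) // weight i = k},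
        H.rep ⟨wedgeBasis (symBasis b n) i, wedgeBasis_mem_weightSpace b hαβ i.2⟩ ≠ 0 := by
  rw [(isGraded_of_homogeneous fun z hz =>
    component_of_mem_hyperplane b hαβ hz).forall_isDecomposable_iff (symBasis b n)]
  constructor
  · intro h i h0
    exact h i (mem_hyperplane.mpr ⟨_, h0⟩)
  · intro h i hi
    obtain ⟨hz, h0⟩ := mem_hyperplane.mp hi
    have hk := (mem_weightSpace_iff b n hαβ k _).mp hz
    rw [component_basis] at hk
    split_ifs at hk with hik
    · exact h ⟨i, hik⟩ h0
    · exact (wedgeBasis (symBasis b n)).ne_zero i hk.symm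

lemma isOpen_setOf_hyperplane (k : ℕ) :
    IsOpen {H : ℙ ℂ (Module.Dual ℂ (weightSpace b α β n k)) |
      ∀ z ∈ hyperplane H, IsDecomposable z → z = 0} := by
  simp only [forall_isDecomposable_hyperplane_iff b hαβ]
  exact isOpen_setOf_rep_ne_zero (fun i : {i : Fin 2 ↪o Fin (n + 1) // weight i = k} =>
    (⟨wedgeBasis (symBasis b n) i, wedgeBasis_mem_weightSpace b hαβ i.2⟩ : weightSpace b α β n k))

lemma nonempty_setOf_hyperplane {k : ℕ} (hk : k ∈ Finset.Icc 1 (2 * n - 1)) :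
    {H : ℙ ℂ (Module.Dual ℂ (weightSpace b α β n k)) |
      ∀ z ∈ hyperplane H, IsDecomposable z → z = 0}.Nonempty := by
  simp only [forall_isDecomposable_hyperplane_iff b hαβ]
  -- The sum of the coordinates takes the value `1` on every basis vector of weight `k`.
  let f : Module.Dual ℂ (weightSpace b α β n k) :=
    (wedgeBasis (symBasis b n)).constr ℂ (fun _ => (1 : ℂ)) ∘ₗ (weightSpace b α β n k).subtype
  have hf1 : ∀ i : {i : Fin 2 ↪o Fin (n + 1) // weight i = k},
      f ⟨wedgeBasis (symBasis b n) i, wedgeBasis_mem_weightSpace b hαβ i.2⟩ = 1 := fun i =>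
    (wedgeBasis (symBasis b n)).constr_basis ℂ _ i.1
  obtain ⟨i, hi⟩ := exists_weight_eq hk
  have hf : f ≠ 0 := fun h => by
    have := hf1 ⟨i, hi⟩
    rw [h, LinearMap.zero_apply] at this
    exact zero_ne_one this
  refine ⟨Projectivization.mk ℂ f hf, fun i h0 => ?_⟩
  rw [mk_rep_apply_eq_zero_iff, hf1] at h0
  exact one_ne_zero h0

lemma component_mem_of_mem_iSup_hyperplane {K : Finset ℕ}
    {H : ∀ k : K, ℙ ℂ (Module.Dual ℂ (weightSpace b α β n k))} {z : ⋀[ℂ]^2 (symPower U n)}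
    (hz : z ∈ ⨆ k, hyperplane (H k)) (k : K) :
    component (wedgeBasis (symBasis b n)) weight k z ∈ hyperplane (H k) := by
  refine component_mem_of_mem_iSup (fun k : K => (k : ℕ)) _
    (fun k z hz => component_of_mem_hyperplane b hαβ hz) hz k _ fun j hj => ?_
  rw [Subtype.ext hj]

lemma component_eq_zero_of_mem_iSup_hyperplane {K : Finset ℕ}
    {H : ∀ k : K, ℙ ℂ (Module.Dual ℂ (weightSpace b α β n k))} {z : ⋀[ℂ]^2 (symPower U n)}
    (hz : z ∈ ⨆ k, hyperplane (H k)) {k : ℕ} (hk : k ∉ K) :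
    component (wedgeBasis (symBasis b n)) weight k z = 0 := by
  rw [← Submodule.mem_bot ℂ]
  exact component_mem_of_mem_iSup (fun k : K => (k : ℕ)) _
    (fun k z hz => component_of_mem_hyperplane b hαβ hz) hz k _ fun j hj => absurd (hj ▸ j.2) hk

end Hyperplanes

section Main

/-! ## Invariant subspaces without decomposable vectors -/

variable {U : Type u} [AddCommGroup U] [Module ℂ U] (b : Module.Basis (Fin 2) ℂ U) {n : ℕ}

lemma finrank_symPower (b : Module.Basis (Fin 2) ℂ U) : Module.finrank ℂ (symPower U n) = n + 1 := by
  rw [Module.finrank_eq_card_basis (symBasis b n), Fintype.card_fin]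

lemma finrank_wedge (b : Module.Basis (Fin 2) ℂ U) [FiniteDimensional ℂ U] :
    Module.finrank ℂ (⋀[ℂ]^2 (symPower U n)) = (n + 1).choose 2 := by
  rw [exteriorPower.finrank_eq, finrank_symPower b]

lemma exists_weight_section (n : ℕ) :
    ∃ σ : Finset.Icc 1 (2 * n - 1) → (Fin 2 ↪o Fin (n + 1)), ∀ k, weight (σ k) = k := by
  choose σ hσ using fun k : Finset.Icc 1 (2 * n - 1) => exists_weight_eq k.2
  exact ⟨σ, hσ⟩

variable {α β : ℤ} (hαβ : α ≠ β)
  {σ : Finset.Icc 1 (2 * n - 1) → (Fin 2 ↪o Fin (n + 1))} (hσ : ∀ k, weight (σ k) = k)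

include hσ

lemma weight_section_injective : Function.Injective fun k => weight (σ k) := fun j k h =>
  Subtype.ext (by simpa [hσ] using h)

lemma finrank_transversal_wedgeBasis :
    Module.finrank ℂ (transversal (wedgeBasis (symBasis b n)) σ) = 2 * n - 1 := by
  rw [finrank_transversal (wt := weight) _ σ (weight_section_injective hσ), Fintype.card_coe,
    Nat.card_Icc, Nat.add_sub_cancel]

variable [FiniteDimensional ℂ U]

include hαβ

/-- Disjointness comes from the grading; (*) makes the dimensions add up to that of `⋀² (Sⁿ U)`. -/
lemma isCompl_transversal (hn : 2 < n) {W : Submodule ℂ (⋀[ℂ]^2 (symPower U n))}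
    (hW : W ∈ invariantSubspaces b α β n) :
    IsCompl (transversal (wedgeBasis (symBasis b n)) σ) W := by
  obtain ⟨hinv, hrank, hdec⟩ := hW
  have hgr := (isInvariant_iff_isGraded b n hαβ W).mp hinv
  refine (Submodule.isCompl_iff_disjoint _ _ ?_).mpr (disjoint_transversal _ σ
    (weight_section_injective hσ) hgr ((hgr.forall_isDecomposable_iff (symBasis b n)).mp hdec))
  rw [finrank_transversal_wedgeBasis b hσ, finrank_wedge b]
  omega

lemma exists_hyperplane_eq (hn : 2 < n) {W : Submodule ℂ (⋀[ℂ]^2 (symPower U n))}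
    (hW : W ∈ invariantSubspaces b α β n) (k : Finset.Icc 1 (2 * n - 1)) :
    ∃ H : ℙ ℂ (Module.Dual ℂ (weightSpace b α β n k)), ∀ z,
      z ∈ hyperplane H ↔ z ∈ weightSpace b α β n k ∧ z ∈ W := by
  have hc := isCompl_transversal b hαβ hσ hn hW
  have hgr := (isInvariant_iff_isGraded b n hαβ W).mp hW.1
  have hW' : ∀ i, wedgeBasis (symBasis b n) i ∉ W :=
    (hgr.forall_isDecomposable_iff (symBasis b n)).mp hW.2.2
  -- The equation of `W` in the weight space is the coordinate at `σ k` of the projection onto the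
  -- transversal along `W`. It is nonzero because the basis vector at `σ k` is not in `W`.
  let f : Module.Dual ℂ (weightSpace b α β n k) :=
    (wedgeBasis (symBasis b n)).coord (σ k) ∘ₗ Submodule.subtype _ ∘ₗ
      (transversal (wedgeBasis (symBasis b n)) σ).projectionOnto W hc ∘ₗ
      (weightSpace b α β n k).subtype
  have hf : ∀ z : weightSpace b α β n k, f z = 0 ↔ (z : ⋀[ℂ]^2 (symPower U n)) ∈ W := fun z => by
    refine (mem_iff_repr_projection_eq_zero (wt := weight) _ σ (weight_section_injective hσ) hgr hc
      ?_).symm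
    rw [hσ]
    exact (mem_weightSpace_iff b n hαβ k _).mp z.2
  have hf0 : f ≠ 0 := fun h => by
    refine hW' (σ k) ((hf ⟨_, wedgeBasis_mem_weightSpace b hαβ (hσ k)⟩).mp ?_)
    rw [h, LinearMap.zero_apply]
  refine ⟨Projectivization.mk ℂ f hf0, fun z => ?_⟩
  simp only [mem_hyperplane, mk_rep_apply_eq_zero_iff, hf, exists_prop]

lemma iSup_hyperplane_mem_invariantSubspaces (hn : 2 < n)
    {H : ∀ k : Finset.Icc 3 (2 * n - 3), ℙ ℂ (Module.Dual ℂ (weightSpace b α β n k))}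
    (hH : ∀ k, ∀ z ∈ hyperplane (H k), IsDecomposable z → z = 0) :
    ⨆ k, hyperplane (H k) ∈ invariantSubspaces b α β n := by
  set W := ⨆ k, hyperplane (H k)
  let B := wedgeBasis (symBasis b n)
  have hgr : IsGraded B weight W :=
    isGraded_iSup (fun k : Finset.Icc 3 (2 * n - 3) => (k : ℕ)) _
      fun k z hz => component_of_mem_hyperplane b hαβ hz
  have hB : ∀ i, B i ∉ W := by
    intro i hi
    have hc : component B weight (weight i) (B i) = B i := by rw [component_basis, if_pos rfl]
    by_cases hk : weight i ∈ Finset.Icc 3 (2 * n - 3)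
    · have h := component_mem_of_mem_iSup_hyperplane b hαβ hi ⟨_, hk⟩
      refine B.ne_zero i (hH ⟨_, hk⟩ _ ?_ (isDecomposable_wedgeBasis _ i))
      rwa [← hc]
    · have h := component_eq_zero_of_mem_iSup_hyperplane b hαβ hi hk
      exact B.ne_zero i (hc.symm.trans h)
  have hdisj := disjoint_transversal B σ (weight_section_injective hσ) hgr hB
  -- In a weight between `3` and `2n - 3`, a basis vector differs from a multiple of the chosen one
  -- by an element of the hyperplane; in the other weights it is the chosen one.
  have hcod : Codisjoint (transversal B σ) W := by
    rw [codisjoint_iff, eq_top_iff, ← B.span_eq, Submodule.span_le]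
    rintro _ ⟨i, rfl⟩
    let k : Finset.Icc 1 (2 * n - 1) := ⟨weight i, weight_mem_Icc i⟩
    have hD : B (σ k) ∈ transversal B σ := Submodule.subset_span ⟨k, rfl⟩
    by_cases hk : weight i ∈ Finset.Icc 3 (2 * n - 3)
    · have h0 := (forall_isDecomposable_hyperplane_iff b hαβ _).mp (hH ⟨_, hk⟩) ⟨σ k, hσ k⟩
      have hW := le_iSup (fun k => hyperplane (H k)) ⟨_, hk⟩
        (sub_div_smul_mem_hyperplane (wedgeBasis_mem_weightSpace b hαβ rfl) _ h0)
      rw [SetLike.mem_coe, ← add_sub_cancel (((H ⟨_, hk⟩).rep ⟨B i, wedgeBasis_mem_weightSpace b hαβ rfl⟩ /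
        (H ⟨_, hk⟩).rep ⟨B (σ k), wedgeBasis_mem_weightSpace b hαβ (hσ k)⟩) • B (σ k)) (B i)]
      exact Submodule.add_mem_sup (Submodule.smul_mem _ _ hD) hW
    · rw [eq_of_weight_eq_of_notMem (hσ k).symm hk]
      exact Submodule.mem_sup_left hD
  refine ⟨(isInvariant_iff_isGraded b n hαβ W).mpr hgr, ?_,
    (hgr.forall_isDecomposable_iff (symBasis b n)).mpr hB⟩
  -- The dimension of `W` is read off from its complement of dimension `2n - 1`.
  have := Submodule.finrank_add_eq_of_isCompl ⟨hdisj, hcod⟩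
  rw [finrank_transversal_wedgeBasis b hσ, finrank_wedge b] at this
  omega

lemma exists_eq_iSup_hyperplane (hn : 2 < n) {W : Submodule ℂ (⋀[ℂ]^2 (symPower U n))}
    (hW : W ∈ invariantSubspaces b α β n) :
    ∃ H : ∀ k : Finset.Icc 3 (2 * n - 3), ℙ ℂ (Module.Dual ℂ (weightSpace b α β n k)),
      (∀ k, hyperplane (H k) ≤ W) ∧ W = ⨆ k, hyperplane (H k) := by
  let B := wedgeBasis (symBasis b n)
  have hsub : ∀ k : Finset.Icc 3 (2 * n - 3), (k : ℕ) ∈ Finset.Icc 1 (2 * n - 1) := fun k => by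
    have := Finset.mem_Icc.mp k.2
    exact Finset.mem_Icc.mpr (by omega)
  choose H hH using fun k : Finset.Icc 3 (2 * n - 3) =>
    exists_hyperplane_eq b hαβ hσ hn hW ⟨k, hsub k⟩
  have hle : ∀ k, hyperplane (H k) ≤ W := fun k z hz => ((hH k z).mp hz).2
  refine ⟨H, hle, le_antisymm (fun z hz => ?_) (iSup_le hle)⟩
  have hgr := (isInvariant_iff_isGraded b n hαβ W).mp hW.1
  have hB : ∀ i, B i ∉ W := (hgr.forall_isDecomposable_iff (symBasis b n)).mp hW.2.2
  have hlt : ∀ i : Fin 2 ↪o Fin (n + 1), weight i < 2 * n := fun i => by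
    have := Finset.mem_Icc.mp (weight_mem_Icc i)
    omega
  rw [← sum_component B weight (2 * n) hlt z]
  refine Submodule.sum_mem _ fun k _ => ?_
  by_cases hk : k ∈ Finset.Icc 3 (2 * n - 3)
  · refine le_iSup (fun k => hyperplane (H k)) ⟨k, hk⟩ ((hH ⟨k, hk⟩ _).mpr ⟨?_, hgr k z hz⟩)
    rw [mem_weightSpace_iff b n hαβ, component_component, if_pos rfl]
  -- At most one basis vector has weight `k`, so a nonzero component would put that vector into `W`.
  · have h0 : component B weight k z = 0 := by
      by_contra hne
      have : ∃ i, weight i = k ∧ B.repr z i ≠ 0 := by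
        by_contra! h
        refine hne (B.repr.injective ?_)
        ext i
        rw [repr_component, map_zero, Finsupp.zero_apply]
        split_ifs with hi
        · exact h i hi
        · rfl
      obtain ⟨i, hi, hzi⟩ := this
      have hsmul : component B weight k z = B.repr z i • B i := by
        apply B.repr.injective
        ext j
        rw [repr_component, map_smul, Finsupp.smul_apply, B.repr_self, smul_eq_mul]
        rcases eq_or_ne j i with rfl | hji
        · rw [if_pos hi, Finsupp.single_eq_same, mul_one]
        · have hj : weight j ≠ k := fun hj => hji
            (eq_of_weight_eq_of_notMem (hj.trans hi.symm) (by rwa [hj]))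
          rw [if_neg hj, Finsupp.single_eq_of_ne hji, mul_zero]
      have h1 := hgr k z hz
      rw [hsmul] at h1
      exact hB i ((W.smul_mem_iff hzi).mp h1)
    rw [h0]
    exact Submodule.zero_mem _

end Main

lemma mem_span_of_projectionOnto_wedge_eq_zero {U : Type u} [AddCommGroup U] [Module ℂ U]
    (b : Module.Basis (Fin 2) ℂ U) {n : ℕ} {W D : Submodule ℂ (⋀[ℂ]^2 (symPower U n))}
    (hD : IsCompl D W) (hW : ∀ z ∈ W, IsDecomposable z → z = 0) (v : symPower U n) (hv : v ≠ 0)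
    (a : symPower U n) (h : D.projectionOnto W hD (wedge a v) = 0) : a ∈ ℂ ∙ v :=
  mem_span_of_wedge_eq_zero (symBasis b n) hv
    (hW _ ((Submodule.projectionOnto_apply_eq_zero_iff hD).mp h) ⟨a, v, rfl⟩)

end TangoBundle

open TangoBundle in
theorem mainTheorem4 {U : Type u} [AddCommGroup U] [Module ℂ U] [FiniteDimensional ℂ U]
    (b : Module.Basis (Fin 2) ℂ U) (α β : ℤ) (hαβ : α ≠ β) (n : ℕ) (hn : 2 < n) :
    (∃ Z : ∀ k : Finset.Icc 3 (2 * n - 3), Set (ℙ ℂ (Module.Dual ℂ (weightSpace b α β n k))),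
      (∀ k, (Z k).Nonempty ∧ IsOpen (Z k) ∧
        Z k = {H | ∀ z ∈ hyperplane H, IsDecomposable z → z = 0}) ∧
      invariantSubspaces b α β n =
        {W | ∃ H : ∀ k : Finset.Icc 3 (2 * n - 3),
            ℙ ℂ (Module.Dual ℂ (weightSpace b α β n k)),
          (∀ k, H k ∈ Z k) ∧ iSupIndep (fun k => hyperplane (H k)) ∧
            W = ⨆ k, hyperplane (H k)}) ∧
    ∀ W ∈ invariantSubspaces b α β n,
      ∃ (D : Submodule ℂ (⋀[ℂ]^2 (symPower U n))) (hD : IsCompl D W),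
        IsInvariant b α β n D ∧
        (tangoSequence hD).ShortExact ∧
        ∀ v : symPower U n, v ≠ 0 →
          Function.Injective (varpiComplFibre hD v) ∧ tangoFibreRank hD v = n - 1 := by
  -- The choice of basis vectors does not depend on `W`, so one complement `D` works for all of
  -- them.
  have hσ := Classical.choose_spec (exists_weight_section n)
  refine ⟨⟨fun k => {H | ∀ z ∈ hyperplane H, IsDecomposable z → z = 0}, fun k => ⟨?_, ?_, rfl⟩, ?_⟩,
    fun W hW => ?_⟩
  · have := Finset.mem_Icc.mp k.2
    exact nonempty_setOf_hyperplane b hαβ (Finset.mem_Icc.mpr (by omega))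
  · exact isOpen_setOf_hyperplane b hαβ k
  · ext W
    constructor
    · intro hW
      obtain ⟨H, hle, hsup⟩ := exists_eq_iSup_hyperplane b hαβ hσ hn hW
      exact ⟨H, fun k z hz => hW.2.2 z (hle k hz), iSupIndep_of_homogeneous
        (d := fun k : Finset.Icc 3 (2 * n - 3) => (k : ℕ)) Subtype.val_injective
        fun k z hz => component_of_mem_hyperplane b hαβ hz, hsup⟩
    · rintro ⟨H, hH, -, rfl⟩
      exact iSup_hyperplane_mem_invariantSubspaces b hαβ hσ hn hH
  · have hD := isCompl_transversal b hαβ hσ hn hW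
    have hL := mem_span_of_projectionOnto_wedge_eq_zero b hD hW.2.2
    refine ⟨_, hD, (isInvariant_iff_isGraded b n hαβ _).mpr (isGraded_transversal _ _ _),
      tangoSequence_shortExact hD hL, fun v hv => ?_⟩
    have hinj := varpiComplFibre_injective hD (hL v hv)
    have h := tangoFibreRank_add hD hv hinj
    rw [finrank_transversal_wedgeBasis b hσ, finrank_symPower b] at h
    -- The rank comes from `rank + (n + 1) = (2n - 1) + 1`.
    exact ⟨hinj, by omega⟩
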